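/- **Setting.** Let $\mathcal G$ be a finite non-empty set of groups. Each group $G$ has a reservoir distribution on $[0,1]$ with CDF $F_G$ and quantile function $F_G^{-1}(p)=\inf\{\tau: F_G(\tau)\ge p\}$. An arm requested from $G$ has an index $j$ drawn uniformly from $[0,1]$ and mean reward $F_G^{-1}(j)$ (so its mean has CDF $F_G$); the index and the mean are not observed. Reward distributions come from a common (measurable) family parametrized by the mean: the distribution belonging to $\mu\in[0,1]$ has mean $\mu$ and is sub-Gaussian with parameter $\sigma^2\le 1$. Given the indices, the rewards of an arm are i.i.d.; different arms are independent. Let $\alpha,\Delta\in(0,1)$ and $0<\delta<\epsilon<\min(\alpha,1-\alpha)$. A group $G$ satisfies the $(\epsilon,\Delta)$-relaxed criterion if $$F_G^{-1}(1-\alpha+\epsilon)\ \ge\ \max_{G'\in\mathcal G}F_{G'}^{-1}(1-\alpha-\epsilon)-\Delta .$$ **Algorithm.** Let $N=\lceil\frac1{2\epsilon^2}\log\frac{2|\mathcal G|}{\delta}\rceil$ and $n=N|\mathcal G|$. Request $N$ arms from each $G\in\mathcal G$; they form the finite group $H_G$. For a finite multiset $X$ let $Q_{1-\alpha}(X)=\inf\{\tau:\#\{x\in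 X:x\le\tau\}\ge(1-\alpha)|X|\}$. After $T\ge1$ pulls, an arm with empirical mean $\hat\mu$ has confidence bounds $\mathrm{LCB}=\hat\mu-U(T,\delta/n)$ and $\mathrm{UCB}=\hat\mu+U(T,\delta/n)$, where $$U(T,\delta')=\sqrt{\frac{2\log(1/\delta')+6\log\log(1/\delta')+3\log\log(eT)}{T}} .$$ Write $\mathrm{UQ}(H)$ and $\mathrm{LQ}(H)$ for $Q_{1-\alpha}$ of the current UCBs, respectively LCBs, of all arms of $H$ (including eliminated arms, whose bounds stay as they were at their last pull). Start with the candidate set $\mathcal C$ of all groups, $m^{(H)}=H$ for every $H$, and width $w=\infty$. While $|\mathcal C|>1$ and $w>\Delta$: pull once every arm that is in $m^{(H)}$ for some $H\in\mathcal C$; keep in $\mathcal C$ those $H$ with $\mathrm{UQ}(H)\ge\mathrm{LQ}(H')$ for all $H'\in\mathcal C$; keep in each $m^{(H)}$ those arms with $\mathrm{LCB}\le\mathrm{UQ}(H)$ and $\mathrm{UCB}\ge\mathrm{LQ}(H)$; and set $w=\max_{H\in\mathcal C}\mathrm{UQ}(H)-\max_{H\in\mathcal C}\mathrm{LQ}(H)$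 for the new $\mathcal C$. When the loop ends, return a group maximizing $\mathrm{LQ}$ over $\mathcal C$, ties being broken arbitrarily (e.g. uniformly at random). Eliminated arms and groups never come back. **Gaps.** Let $G^*_\epsilon\in\operatorname{argmax}_{G}F_G^{-1}(1-\alpha+\epsilon)$ (any choice) and $$\widetilde\Delta_G=\max_{G'}F_{G'}^{-1}(1-\alpha-\epsilon)-F_G^{-1}(1-\alpha+\epsilon),\qquad \widetilde\Delta_0=\max_{G}F_G^{-1}(1-\alpha-\epsilon)-\max_{G'\ne G^*_\epsilon}F_{G'}^{-1}(1-\alpha+\epsilon),$$ with $\widetilde\Delta_0=0$ if $|\mathcal G|=1$. Let $\ell=\lfloor\frac{1-\alpha}\epsilon\rfloor$, let $m$ be the smallest natural number with $m\ge\frac\alpha\epsilon+\ell$, and $b_i=(1-\alpha)-\ell\epsilon+(i-1)\epsilon$. Put $$\widetilde\Delta'_{G,i}=\begin{cases}F_G^{-1}(1-\alpha-\epsilon)-F_G^{-1}(b_{i+1}), & i<\ell-1,\\ F_G^{-1}(b_i)-F_G^{-1}(1-\alpha+\epsilon), & i>\ell+1,\\ 0,&\text{otherwise,}\end{cases}\qquad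 \widetilde\Delta_{G,i}=\max\{\Delta,\widetilde\Delta_G,\widetilde\Delta_0,\widetilde\Delta'_{G,i}\}.$$ **Claim.** There are universal constants $c,d>0$ such that in every such setting, with probability at least $1-3\delta$, the algorithm terminates, returns a group satisfying the $(\epsilon,\Delta)$-relaxed criterion, and the total number $T$ of arm pulls satisfies $$T\ \le\ \sum_{G\in\mathcal G}\sum_{i=1}^m\frac{c}{\widetilde\Delta_{G,i}^2}\log\Big(\frac{|\mathcal G|N}{\delta}\max\Big\{1,\log\frac1{\widetilde\Delta_{G,i}^2}\Big\}\Big)\cdot3\epsilon N,$$ and, moreover, the right-hand side is at most $$d\,\frac{|\mathcal G|}{\epsilon^2\Delta^2}\Big(\log^2\frac{|\mathcal G|}\delta+\log\frac{|\mathcal G|}\delta\cdot\log\max\Big\{1,\log\frac1\Delta\Big\}\Big).$$ -/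

import Mathlib

universe u

noncomputable section

namespace QuantileBandit

open MeasureTheory ProbabilityTheory
open scoped NNReal

/-! ### Quantiles -/

/-- The quantile function `F⁻¹(p) = inf {τ : F(τ) ≥ p}` of a distribution `ν` on `ℝ` with
cumulative distribution function `F`. -/
def quantile (ν : Measure ℝ) (p : ℝ) : ℝ := sInf {τ : ℝ | p ≤ cdf ν τ}

/-- The `p`-quantile `Q_p` of the finite multiset `{x 0, …, x (N-1)}`. -/
def empQuantile {N : ℕ} (p : ℝ) (x : Fin N → ℝ) : ℝ :=
  sInf {τ : ℝ | p ≤ ((Finset.univ.filter fun k => x k ≤ τ).card : ℝ) / N}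

theorem quantile_le_iff (ν : Measure ℝ) {p : ℝ} (hp : p ∈ Set.Ioo (0 : ℝ) 1) (x : ℝ) :
    quantile ν p ≤ x ↔ p ≤ cdf ν x := by
  have hne : {τ : ℝ | p ≤ cdf ν τ}.Nonempty := by
    obtain ⟨y, hy⟩ := ((tendsto_cdf_atTop ν).eventually (lt_mem_nhds hp.2)).exists
    exact ⟨y, hy.le⟩
  have hbd : BddBelow {τ : ℝ | p ≤ cdf ν τ} := by
    obtain ⟨y, hy⟩ := ((tendsto_cdf_atBot ν).eventually (gt_mem_nhds hp.1)).exists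
    refine ⟨y, fun τ hτ => ?_⟩
    by_contra h
    exact absurd (le_trans hτ (monotone_cdf ν (not_le.mp h).le)) (not_le.mpr hy)
  constructor
  · intro h
    have hr : Filter.Tendsto (cdf ν) (nhdsWithin x (Set.Ioi x)) (nhds (cdf ν x)) :=
      ((cdf ν).right_continuous x).tendsto.mono_left (nhdsWithin_mono x Set.Ioi_subset_Ici_self)
    refine ge_of_tendsto hr ?_
    filter_upwards [self_mem_nhdsWithin] with y hy
    obtain ⟨z, hz, hzy⟩ := exists_lt_of_csInf_lt hne (lt_of_le_of_lt h hy)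
    exact le_trans hz (monotone_cdf ν hzy.le)
  · intro h
    exact csInf_le hbd h

theorem measurable_quantile (ν : Measure ℝ) : Measurable (quantile ν) := by
  refine measurable_of_Iic fun x => ?_
  have h0 : ∀ p : ℝ, p ≤ 0 → quantile ν p = 0 := fun p hp => by
    have : {τ : ℝ | p ≤ cdf ν τ} = Set.univ :=
      Set.eq_univ_of_forall fun τ => le_trans hp (cdf_nonneg ν τ)
    rw [quantile, this, Real.sInf_univ]
  have h1 : ∀ p : ℝ, 1 < p → quantile ν p = 0 := fun p hp => by
    have : {τ : ℝ | p ≤ cdf ν τ} = ∅ :=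
      Set.eq_empty_of_forall_notMem fun τ hτ =>
        absurd (le_trans hτ (cdf_le_one ν τ)) (not_le.mpr hp)
    rw [quantile, this, Real.sInf_empty]
  have hset : quantile ν ⁻¹' Set.Iic x =
      (Set.Ioo 0 1 ∩ Set.Iic (cdf ν x)) ∪ ({1} ∩ quantile ν ⁻¹' Set.Iic x) ∪
        ((Set.Iic 0 ∪ Set.Ioi 1) ∩ {_p : ℝ | 0 ≤ x}) := by
    ext p
    simp only [Set.mem_preimage, Set.mem_Iic, Set.mem_union, Set.mem_inter_iff, Set.mem_Ioo,
      Set.mem_singleton_iff, Set.mem_Ioi, Set.mem_ofPred_eq]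
    rcases le_or_gt p 0 with hp | hp
    · rw [h0 p hp]
      constructor
      · intro h
        exact Or.inr ⟨Or.inl hp, h⟩
      · rintro ((h | h) | h)
        · linarith [h.1.1]
        · linarith [h.1]
        · exact h.2
    · rcases lt_trichotomy p 1 with hq | hq | hq
      · rw [quantile_le_iff ν ⟨hp, hq⟩]
        constructor
        · intro h
          exact Or.inl (Or.inl ⟨⟨hp, hq⟩, h⟩)
        · rintro ((h | h) | h)
          · exact h.2
          · linarith [h.1]
          · rcases h.1 with h | h <;> linarith
      · constructor
        · intro h
          exact Or.inl (Or.inr ⟨hq, h⟩)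
        · rintro ((h | h) | h)
          · linarith [h.1.2]
          · exact h.2
          · rcases h.1 with h | h <;> linarith
      · rw [h1 p hq]
        constructor
        · intro h
          exact Or.inr ⟨Or.inr hq, h⟩
        · rintro ((h | h) | h)
          · linarith [h.1.2]
          · linarith [h.1]
          · exact h.2
  rw [hset]
  refine ((measurableSet_Ioo.inter measurableSet_Iic).union ?_).union
    ((measurableSet_Iic.union measurableSet_Ioi).inter (MeasurableSet.const _))
  exact (Set.subsingleton_singleton.anti Set.inter_subset_left).measurableSet

/-! ### The random environment -/

/-- The law of an i.i.d. sequence of rewards of an arm of mean `m`, where `κ m` is the reward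
distribution of mean `m`. -/
def rewardKernel (κ : Kernel ℝ ℝ) [IsMarkovKernel κ] : Kernel ℝ (ℕ → ℝ) where
  toFun m := Measure.infinitePi fun _ : ℕ => κ m
  measurable' := by
    refine Measurable.measure_of_isPiSystem_of_isProbabilityMeasure
      (generateFrom_squareCylinders (α := fun _ : ℕ => ℝ)).symm
      (isPiSystem_squareCylinders (fun _ => MeasurableSpace.isPiSystem_measurableSet)
        (by simp)) ?_
    rintro _ ⟨s, t, ht, rfl⟩
    have ht' : ∀ i ∈ s, MeasurableSet (t i) := fun i _ => ht i (Set.mem_univ i)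
    simp_rw [Measure.infinitePi_pi _ ht']
    exact Finset.measurable_fun_prod _ fun i hi => κ.measurable_coe (ht' i hi)

instance (κ : Kernel ℝ ℝ) [IsMarkovKernel κ] : IsMarkovKernel (rewardKernel κ) :=
  ⟨fun m => inferInstanceAs (IsProbabilityMeasure (Measure.infinitePi fun _ : ℕ => κ m))⟩

/-- The joint law of (index, reward sequence) of an arm requested from a group with reservoir
distribution `ν`: the index `j` is uniform on `[0,1]`, the mean of the arm is `F⁻¹(j)`, and given
`j` the rewards are i.i.d. with the reward distribution of that mean. -/
def armLaw (ν : Measure ℝ) (κ : Kernel ℝ ℝ) [IsMarkovKernel κ] : Measure (ℝ × (ℕ → ℝ)) :=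
  (volume.restrict (Set.Icc (0 : ℝ) 1)) ⊗ₘ
    ((rewardKernel κ).comap (quantile ν) (measurable_quantile ν))

instance : IsProbabilityMeasure (volume.restrict (Set.Icc (0 : ℝ) 1)) := ⟨by simp⟩

instance (ν : Measure ℝ) (κ : Kernel ℝ ℝ) [IsMarkovKernel κ] :
    IsProbabilityMeasure (armLaw ν κ) := by
  unfold armLaw
  infer_instance

/-- The number `N = ⌈(1 / (2 ε²)) log (2 |𝒢| / δ)⌉` of arms requested from each group, where
`g = |𝒢|`. -/
def numArms (g : ℕ) (ε δ : ℝ) : ℕ := ⌈1 / (2 * ε ^ 2) * Real.log (2 * g / δ)⌉₊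

/-- Outcomes: `ω (G, k) = (j, X)`, where `j` is the index of the `k`-th arm requested from group `G`
and `X t` is the reward that this arm yields if it is pulled in round `t` (counted from `0`). -/
abbrev Outcome (ι : Type u) (N : ℕ) : Type u := ι × Fin N → ℝ × (ℕ → ℝ)

/-- All arms are requested, and yield rewards, independently of each other. -/
def environment {ι : Type u} [Fintype ι] (N : ℕ) (ν : ι → Measure ℝ) (κ : Kernel ℝ ℝ)
    [IsMarkovKernel κ] : Measure (Outcome ι N) :=
  Measure.pi fun a : ι × Fin N => armLaw (ν a.1) κ

/-! ### The finite-arm elimination algorithm -/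

/-- `U(T, δ)`, the width of the confidence interval of an arm after `T` pulls. -/
def confWidth (T : ℕ) (δ : ℝ) : ℝ :=
  √((2 * Real.log (1 / δ) + 6 * Real.log (Real.log (1 / δ))
      + 3 * Real.log (Real.log (Real.exp 1 * T))) / T)

/-- What the algorithm remembers at the beginning of a round: the candidate groups, for each group
the potential quantile arms, the number of pulls and the sum of the observed rewards of each arm,
and the width `Δ⁽ᵗ⁾`. -/
structure Memory (ι : Type u) (N : ℕ) where
  cand : Finset ι
  pot : ι → Finset (Fin N)
  pulls : ι → Fin N → ℕ
  total : ι → Fin N → ℝ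
  width : EReal

namespace Memory

variable {ι : Type u} {N : ℕ}

/-- The memory at the beginning of the first round. -/
def init (ι : Type u) [Fintype ι] (N : ℕ) : Memory ι N where
  cand := Finset.univ
  pot _ := Finset.univ
  pulls _ _ := 0
  total _ _ := 0
  width := ⊤

/-- The active arms, i.e. those that are pulled in the next round. -/
def Active (st : Memory ι N) (G : ι) (k : Fin N) : Prop := G ∈ st.cand ∧ k ∈ st.pot G

/-- The condition of the while-loop. -/
def Running (Δ : ℝ) (st : Memory ι N) : Prop := 1 < st.cand.card ∧ (Δ : EReal) < st.width

/-- The total number of arm pulls so far. -/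
def totalPulls [Fintype ι] (st : Memory ι N) : ℕ := ∑ G, ∑ k, st.pulls G k

/-- The empirical mean of an arm. -/
def empMean (st : Memory ι N) (G : ι) (k : Fin N) : ℝ := st.total G k / st.pulls G k

/-- Lower confidence bound, with confidence parameter `δ / n`, where `n` is the number of arms. -/
def lcb [Fintype ι] (δ : ℝ) (st : Memory ι N) (G : ι) (k : Fin N) : ℝ :=
  st.empMean G k - confWidth (st.pulls G k) (δ / (N * Fintype.card ι : ℕ))

/-- Upper confidence bound. -/
def ucb [Fintype ι] (δ : ℝ) (st : Memory ι N) (G : ι) (k : Fin N) : ℝ :=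
  st.empMean G k + confWidth (st.pulls G k) (δ / (N * Fintype.card ι : ℕ))

/-- `Q_{1-α}` of the lower confidence bounds of all arms of a group. -/
def lcbQuantile [Fintype ι] (α δ : ℝ) (st : Memory ι N) (G : ι) : ℝ :=
  empQuantile (1 - α) (st.lcb δ G)

/-- `Q_{1-α}` of the upper confidence bounds of all arms of a group. -/
def ucbQuantile [Fintype ι] (α δ : ℝ) (st : Memory ι N) (G : ι) : ℝ :=
  empQuantile (1 - α) (st.ucb δ G)

open Classical in
/-- Pull every active arm once, where `x G k` is the reward that arm `k` of group `G` yields. -/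
def pull (x : ι → Fin N → ℝ) (st : Memory ι N) : Memory ι N :=
  { st with
    pulls := fun G k => if st.Active G k then st.pulls G k + 1 else st.pulls G k
    total := fun G k => if st.Active G k then st.total G k + x G k else st.total G k }

open Classical in
/-- Eliminate groups and arms according to the current confidence bounds, and update the width. -/
def eliminate [Fintype ι] (α δ : ℝ) (st : Memory ι N) : Memory ι N :=
  let cand' : Finset ι := st.cand.filter fun G =>
    ∀ G' ∈ st.cand, st.lcbQuantile α δ G' ≤ st.ucbQuantile α δ G
  { st with
    cand := cand'
    pot := fun G => (st.pot G).filter fun k =>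
      st.lcb δ G k ≤ st.ucbQuantile α δ G ∧ st.lcbQuantile α δ G ≤ st.ucb δ G k
    width := ((sSup (st.ucbQuantile α δ '' (cand' : Set ι))
      - sSup (st.lcbQuantile α δ '' (cand' : Set ι)) : ℝ) : EReal) }

open Classical in
/-- The memory after `t` rounds, when `x t G k` is the reward of arm `k` of group `G` in round `t`;
nothing changes any more once the loop has been left. -/
def run [Fintype ι] (α Δ δ : ℝ) (x : ℕ → ι → Fin N → ℝ) : ℕ → Memory ι N
  | 0 => init ι N
  | t + 1 =>
    let st := run α Δ δ x t
    if st.Running Δ then (st.pull (x t)).eliminate α δ else st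

/-- `G` maximizes `Q_{1-α}` of the lower confidence bounds among the candidate groups, so the
algorithm may return it (the choice among several maximizers is a matter of tie-breaking). -/
def MayReturn [Fintype ι] (α δ : ℝ) (st : Memory ι N) (G : ι) : Prop :=
  G ∈ st.cand ∧ ∀ G' ∈ st.cand, st.lcbQuantile α δ G' ≤ st.lcbQuantile α δ G

end Memory

/-! ### The success criterion and the gaps -/

section Gaps

variable {ι : Type u}

/-- The `(ε, Δ)`-relaxed criterion:
`F_G⁻¹(1 - α + ε) ≥ max_{G'} F_{G'}⁻¹(1 - α - ε) - Δ`. -/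
def RelaxedOptimal (ν : ι → Measure ℝ) (α ε Δ : ℝ) (G : ι) : Prop :=
  ∀ G' : ι, quantile (ν G') (1 - α - ε) - Δ ≤ quantile (ν G) (1 - α + ε)

/-- `Δ̃_G`. -/
def groupGap (ν : ι → Measure ℝ) (α ε : ℝ) (G : ι) : ℝ :=
  (⨆ G' : ι, quantile (ν G') (1 - α - ε)) - quantile (ν G) (1 - α + ε)

open Classical in
/-- `Δ̃₀`, where `Gs` is a group with the highest `(1 - α + ε)`-quantile; if there is no other group,
then this gap is void and set to `0`. -/
def topGap (ν : ι → Measure ℝ) (α ε : ℝ) (Gs : ι) : ℝ :=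
  if ∃ G' : ι, G' ≠ Gs then
    (⨆ G : ι, quantile (ν G) (1 - α - ε))
      - ⨆ G' : {G' : ι // G' ≠ Gs}, quantile (ν G') (1 - α + ε)
  else 0

/-- `⌊(1 - α) / ε⌋`. -/
def lowCells (α ε : ℝ) : ℕ := ⌊(1 - α) / ε⌋₊

/-- `m`, the smallest natural number that is at least `α / ε + ⌊(1 - α) / ε⌋`. -/
def numCells (α ε : ℝ) : ℕ := ⌈α / ε + lowCells α ε⌉₊

/-- The left ends `b_i = (1 - α) - ⌊(1 - α) / ε⌋ ε + (i - 1) ε` of the cells. -/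
def cellStart (α ε : ℝ) (i : ℕ) : ℝ := (1 - α) - lowCells α ε * ε + ((i : ℝ) - 1) * ε

/-- `Δ̃'_{G,i}`. -/
def cellGap (ν : ι → Measure ℝ) (α ε : ℝ) (G : ι) (i : ℕ) : ℝ :=
  if (i : ℤ) < (lowCells α ε : ℤ) - 1 then
    quantile (ν G) (1 - α - ε) - quantile (ν G) (cellStart α ε (i + 1))
  else if (lowCells α ε : ℤ) + 1 < i then
    quantile (ν G) (cellStart α ε i) - quantile (ν G) (1 - α + ε)
  else 0

/-- `Δ̃_{G,i} = max {Δ, Δ̃_G, Δ̃₀, Δ̃'_{G,i}}`. -/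
def gap (ν : ι → Measure ℝ) (α ε Δ : ℝ) (Gs G : ι) (i : ℕ) : ℝ :=
  max (max Δ (groupGap ν α ε G)) (max (topGap ν α ε Gs) (cellGap ν α ε G i))

variable [Fintype ι]

/-- The instance-dependent bound on the number of pulls. -/
def instanceBound (c : ℝ) (ν : ι → Measure ℝ) (α ε Δ δ : ℝ) (Gs : ι) : ℝ :=
  ∑ G : ι, ∑ i ∈ Finset.Icc 1 (numCells α ε),
    c / gap ν α ε Δ Gs G i ^ 2
      * Real.log (Fintype.card ι * numArms (Fintype.card ι) ε δ / δ
          * max 1 (Real.log (1 / gap ν α ε Δ Gs G i ^ 2)))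
      * (3 * ε * numArms (Fintype.card ι) ε δ)

/-- The worst-case bound on the number of pulls, where `g = |𝒢|`. -/
def worstCaseBound (d : ℝ) (g : ℕ) (ε Δ δ : ℝ) : ℝ :=
  d * (g / (ε ^ 2 * Δ ^ 2))
    * (Real.log (g / δ) ^ 2 + Real.log (g / δ) * Real.log (max 1 (Real.log (1 / Δ))))

/-- The event that the two-step algorithm halts, that whichever group it returns satisfies the
relaxed criterion, and that it has made at most `B` pulls. -/
def Succeeds {N : ℕ} (ν : ι → Measure ℝ) (α ε Δ δ B : ℝ) (ω : Outcome ι N) : Prop :=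
  ∃ t : ℕ, ∃ st : Memory ι N, st = Memory.run α Δ δ (fun s G k => (ω (G, k)).2 s) t ∧
    ¬ st.Running Δ ∧
    (∃ G : ι, st.MayReturn α δ G) ∧
    (∀ G : ι, st.MayReturn α δ G → RelaxedOptimal ν α ε Δ G) ∧
    (st.totalPulls : ℝ) ≤ B

end Gaps

end QuantileBandit

end

namespace QuantileBandit

open MeasureTheory ProbabilityTheory

/-! ### Ville's inequality and line crossings of sub-Gaussian walks -/

section Ville

variable {Ω : Type*} {mΩ : MeasurableSpace Ω} {P : Measure Ω} [IsProbabilityMeasure P]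

/-! The randomness is confined to one good event (`GoodOutcome`) of probability at least 1 - 3δ; on
it the whole run of the algorithm is analysed deterministically. On this event every confidence
interval contains its mean at all times, every group has fewer than αN arms of index above 1-α+ε and
fewer than (1-α)N of index below 1-α-ε, and every cell of indices holds fewer than 4εN arms. The
counts come from Hoeffding's inequality and the choice of N. The intervals come from a finite-time
law of the iterated logarithm: time is cut into geometric slices, Ville's inequality bounds the
crossing of one line per slice, and the failure probabilities are summable.

The index counts place the empirical quantile q_G of the arm means between F_G⁻¹(1-α-ε) and
F_G⁻¹(1-α+ε), so it suffices to compare the q_G up to Δ. Let W be the confidence width after t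
rounds. For a candidate group, UQ and LQ are within 2W of q_G: arms still in play have width W, and
an eliminated arm has its frozen interval strictly on the correct side of q_G. Hence a best group is
never eliminated, and whatever survives a round is within 4W of the threshold that would eliminate
it (`Invariant.step`).

So an arm can be pulled again only while its gap is at most 4W (`gap_le_of_unresolved`). Solving
this inequality for t bounds the pulls of one arm (`le_of_le_four_mul_confWidth`), and multiplying
by the number of arms per cell gives the instance-dependent bound. The worst-case bound replaces
every gap by Δ and uses that the number of cells is of order 1/ε. -/

theorem martingale_prod_of_iIndepFun {Z : ℕ → Ω → ℝ} (hZ : ∀ i, StronglyMeasurable (Z i))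
    (hind : iIndepFun Z P) (hint : ∀ i, Integrable (Z i) P) (h1 : ∀ i, ∫ ω, Z i ω ∂P = 1) :
    Martingale (fun n => ∏ i ∈ Finset.range (n + 1), Z i) (Filtration.natural Z hZ) P := by
  have hadp : StronglyAdapted (Filtration.natural Z hZ)
      (fun n => ∏ i ∈ Finset.range (n + 1), Z i) := fun n =>
    Finset.stronglyMeasurable_prod _ fun i hi =>
      (Filtration.stronglyAdapted_natural hZ i).mono
        ((Filtration.natural Z hZ).mono (Finset.mem_range_succ_iff.mp hi))
  have hI : ∀ n, Integrable (∏ i ∈ Finset.range (n + 1), Z i) P := by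
    intro n
    induction n with
    | zero => simpa using hint 0
    | succ n ih =>
      rw [Finset.prod_range_succ]
      exact (hind.indepFun_finsetProd_of_notMem (fun i => (hZ i).measurable)
        Finset.notMem_range_self).integrable_mul ih (hint _)
  refine martingale_nat hadp hI fun n => ?_
  have hsplit : (∏ i ∈ Finset.range (n + 1 + 1), Z i)
      = (∏ i ∈ Finset.range (n + 1), Z i) * Z (n + 1) := Finset.prod_range_succ _ _
  have hmul := condExp_mul_of_stronglyMeasurable_left (μ := P) (hadp n)
    (hsplit ▸ hI (n + 1)) (hint (n + 1))
  have hc := condExp_indep_eq (hZ (n + 1)).measurable.comap_le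
    ((Filtration.natural Z hZ).le n) (comap_measurable (Z (n + 1))).stronglyMeasurable
    (hind.indep_comap_natural_of_lt hZ (Nat.lt_succ_self n))
  simp only [hsplit]
  filter_upwards [hmul, hc] with ω h2 h3
  rw [h2, Pi.mul_apply, h3, h1, mul_one]

/-- **Ville's inequality** for products of independent nonnegative variables of mean one. -/
theorem measure_exists_le_prod_le {Z : ℕ → Ω → ℝ} (hZ : ∀ i, StronglyMeasurable (Z i))
    (hind : iIndepFun Z P) (hint : ∀ i, Integrable (Z i) P) (h1 : ∀ i, ∫ ω, Z i ω ∂P = 1)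
    (h0 : ∀ i ω, 0 ≤ Z i ω) {C : ℝ} (hC : 0 < C) :
    P {ω | ∃ n, C ≤ ∏ i ∈ Finset.range (n + 1), Z i ω} ≤ ENNReal.ofReal C⁻¹ := by
  have hM := martingale_prod_of_iIndepFun hZ hind hint h1
  have hn0 : (0 : ℕ → Ω → ℝ) ≤ fun n => ∏ i ∈ Finset.range (n + 1), Z i := fun n ω => by
    simpa using Finset.prod_nonneg fun i _ => h0 i ω
  have hset : {ω | ∃ n, C ≤ ∏ i ∈ Finset.range (n + 1), Z i ω}
      = ⋃ n : ℕ, {ω | ∃ k ≤ n, C ≤ ∏ i ∈ Finset.range (k + 1), Z i ω} := by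
    ext ω
    simp only [Set.mem_ofPred_eq, Set.mem_iUnion]
    exact ⟨fun ⟨n, h⟩ => ⟨n, n, le_rfl, h⟩, fun ⟨_, k, _, h⟩ => ⟨k, h⟩⟩
  have hmono : Monotone fun n : ℕ => {ω | ∃ k ≤ n, C ≤ ∏ i ∈ Finset.range (k + 1), Z i ω} :=
    fun n n' hnn ω ⟨k, hk, h⟩ => ⟨k, hk.trans hnn, h⟩
  -- The maximal inequality has a finite horizon; continuity from below along these increasing
  -- events removes it.
  rw [hset, hmono.measure_iUnion]
  refine iSup_le fun n => ?_
  have hmax := maximal_ineq hM.submartingale hn0 (ε := ⟨C, hC.le⟩) n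
  have hE : {ω | ∃ k ≤ n, C ≤ ∏ i ∈ Finset.range (k + 1), Z i ω}
      = {ω | ((⟨C, hC.le⟩ : NNReal) : ℝ) ≤ (Finset.range (n + 1)).sup' Finset.nonempty_range_add_one
        fun k => (∏ i ∈ Finset.range (k + 1), Z i) ω} := by
    ext ω
    simp [Finset.le_sup'_iff, Finset.prod_apply]
  have hle : (∫ ω in {ω | ((⟨C, hC.le⟩ : NNReal) : ℝ) ≤ (Finset.range (n + 1)).sup'
      Finset.nonempty_range_add_one fun k => (∏ i ∈ Finset.range (k + 1), Z i) ω},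
      (∏ i ∈ Finset.range (n + 1), Z i) ω ∂P) ≤ 1 := by
    refine (setIntegral_le_integral (hM.integrable n) (ae_of_all _ fun ω => hn0 n ω)).trans ?_
    have h3 : ∀ m : ℕ, ∫ ω, (∏ i ∈ Finset.range (m + 1), Z i) ω ∂P = 1 := by
      intro m
      have := hM.setIntegral_eq (Nat.zero_le m) MeasurableSet.univ
      simp only [Measure.restrict_univ] at this
      rw [← this]
      simpa using h1 0
    exact (h3 n).le
  rw [hE]
  have h4 := hmax.trans (ENNReal.ofReal_le_ofReal hle)
  rw [ENNReal.ofReal_one] at h4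
  rw [ENNReal.ofReal_inv_of_pos hC, ENNReal.le_inv_iff_mul_le, mul_comm]
  rw [ENNReal.ofReal_eq_coe_nnreal hC.le]
  exact h4

/-- A sub-Gaussian random walk stays below a line with high probability. -/
theorem measure_exists_line_crossing_le {Y : ℕ → Ω → ℝ} (hY : ∀ i, Measurable (Y i))
    (hind : iIndepFun Y P) {s : NNReal} (hs : s ≤ 1) (hsub : ∀ i, HasSubgaussianMGF (Y i) s P)
    (l x : ℝ) :
    P {ω | ∃ T : ℕ, 1 ≤ T ∧ x ≤ l * ∑ i ∈ Finset.range T, Y i ω - l ^ 2 * T / 2}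
      ≤ ENNReal.ofReal (Real.exp (-x)) := by
  -- Dividing by the exact moment generating function makes the mean equal to one, as Ville's
  -- inequality requires; the sub-Gaussian bound exp(l²/2) enters only when comparing products.
  set Z : ℕ → Ω → ℝ := fun i ω => Real.exp (l * Y i ω) / mgf (Y i) P l with hZdef
  have hpos : ∀ i, 0 < mgf (Y i) P l := fun i => mgf_pos ((hsub i).integrable_exp_mul l)
  have hg : ∀ i, Measurable fun y : ℝ => Real.exp (l * y) / mgf (Y i) P l := fun i => by fun_prop
  have hZm : ∀ i, Measurable (Z i) := fun i => (hg i).comp (hY i)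
  have hZind : iIndepFun Z P := hind.comp _ hg
  have hb : ∀ i, mgf (Y i) P l ≤ Real.exp (l ^ 2 / 2) := fun i => by
    refine ((hsub i).mgf_le l).trans (Real.exp_le_exp.mpr ?_)
    have : (s : ℝ) ≤ 1 := by exact_mod_cast hs
    nlinarith [sq_nonneg l]
  rw [Real.exp_neg]
  refine (measure_mono ?_).trans (measure_exists_le_prod_le (fun i => (hZm i).stronglyMeasurable)
    hZind (fun i => ((hsub i).integrable_exp_mul l).div_const _) (fun i => ?_)
    (fun i ω => div_nonneg (Real.exp_pos _).le (hpos i).le) (Real.exp_pos x))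
  · rintro ω ⟨T, hT, hx⟩
    obtain ⟨n, rfl⟩ : ∃ n, T = n + 1 := ⟨T - 1, by omega⟩
    refine ⟨n, (Real.exp_le_exp.mpr hx).trans ?_⟩
    have : Real.exp (l * ∑ i ∈ Finset.range (n + 1), Y i ω - l ^ 2 * ((n + 1 : ℕ) : ℝ) / 2)
        = ∏ i ∈ Finset.range (n + 1), Real.exp (l * Y i ω) / Real.exp (l ^ 2 / 2) := by
      simp_rw [← Real.exp_sub]
      rw [← Real.exp_sum, Finset.sum_sub_distrib, ← Finset.mul_sum]
      simp
      ring
    rw [this]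
    refine Finset.prod_le_prod (fun i _ => by positivity) fun i _ => ?_
    exact div_le_div_of_nonneg_left (Real.exp_pos _).le (hpos i) (hb i)
  · simp only [hZdef, integral_div]
    exact div_self (hpos i).ne'

end Ville

/-! ### A finite-time law of the iterated logarithm -/

section IteratedLogarithm

/-- The (squared) height of the iterated-logarithm boundary on the `k`-th time slice. -/
noncomputable def sliceLevel (L : ℝ) (k : ℕ) : ℝ :=
  L + 3 * Real.log L + 3 / 2 * Real.log (1 + k * (2 / √L))

/-- The exponent of the failure probability on the `k`-th time slice. -/
noncomputable def sliceExponent (L : ℝ) (k : ℕ) : ℝ := (1 - 1 / (4 * L)) * sliceLevel L k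

/-- The slope of the line that is used on the `k`-th time slice. -/
noncomputable def sliceSlope (L : ℝ) (k : ℕ) : ℝ :=
  √(2 * sliceExponent L k / Real.exp ((k + 1 / 2) * (2 / √L)))

theorem log_one_add_natCast_mul_nonneg {a : ℝ} (ha : 0 ≤ a) (k : ℕ) :
    0 ≤ Real.log (1 + k * a) :=
  Real.log_nonneg (by have : 0 ≤ (k : ℝ) * a := by positivity
                      linarith)

theorem sliceLevel_pos {L : ℝ} (hL : 3 ≤ L) (k : ℕ) : 0 < sliceLevel L k := by
  have h1 : 0 ≤ Real.log L := Real.log_nonneg (by linarith)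
  have h2 := log_one_add_natCast_mul_nonneg (a := 2 / √L) (by positivity) k
  unfold sliceLevel
  linarith

theorem sliceExponent_pos {L : ℝ} (hL : 3 ≤ L) (k : ℕ) : 0 < sliceExponent L k := by
  refine mul_pos ?_ (sliceLevel_pos hL k)
  have : 1 / (4 * L) ≤ 1 / 12 := one_div_le_one_div_of_le (by norm_num) (by linarith)
  linarith

/-- Slice k consists of the T with log T in [ka, (k+1)a), where a = 2/√L. Its line is tuned to the
geometric midpoint exp((k+1/2)a). Elsewhere in the slice the tangency is lost by a factor cosh w
with |w| ≤ a/4, and cosh² w ≤ exp(1/(4L)). The factor 1 - 1/(4L) in the exponent absorbs exactly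
this loss. -/
theorem exists_slice_crossing {L T S : ℝ} (hL : 3 ≤ L) (hT : 1 ≤ T)
    (hS : √(T * (2 * L + 6 * Real.log L + 3 * Real.log (1 + Real.log T))) < S) :
    ∃ k : ℕ, sliceExponent L k ≤ sliceSlope L k * S - sliceSlope L k ^ 2 * T / 2 := by
  set a : ℝ := 2 / √L with ha
  have hsq : 0 < √L := Real.sqrt_pos.mpr (by linarith)
  have ha0 : 0 < a := by positivity
  have hlT : 0 ≤ Real.log T := Real.log_nonneg hT
  refine ⟨⌊Real.log T / a⌋₊, ?_⟩
  set k := ⌊Real.log T / a⌋₊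
  have hk1 : k * a ≤ Real.log T := by
    rw [← le_div_iff₀ ha0]
    exact Nat.floor_le (by positivity)
  have hk2 : Real.log T < (k + 1) * a := by
    rw [← div_lt_iff₀ ha0]
    exact Nat.lt_floor_add_one _
  have hx := sliceExponent_pos hL k
  have hβ := sliceLevel_pos hL k
  have hβT : T * (2 * sliceLevel L k)
      ≤ T * (2 * L + 6 * Real.log L + 3 * Real.log (1 + Real.log T)) := by
    have : Real.log (1 + k * a) ≤ Real.log (1 + Real.log T) :=
      Real.log_le_log (by positivity) (by linarith)
    refine mul_le_mul_of_nonneg_left ?_ (by linarith)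
    unfold sliceLevel
    linarith
  have hS' : √(T * (2 * sliceLevel L k)) ≤ S := (Real.sqrt_le_sqrt hβT).trans hS.le
  set w : ℝ := (Real.log T - (k + 1 / 2) * a) / 2 with hw
  set v : ℝ := Real.exp w with hv
  have hv0 : 0 < v := Real.exp_pos _
  have hv2 : v ^ 2 = T / Real.exp ((k + 1 / 2) * a) := by
    rw [hv, ← Real.exp_nat_mul, eq_div_iff (Real.exp_pos _).ne', ← Real.exp_add]
    rw [hw]
    push_cast
    rw [show 2 * ((Real.log T - (k + 1 / 2) * a) / 2) + (k + 1 / 2) * a = Real.log T by ring]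
    exact Real.exp_log (by linarith)
  have hwsq : w ^ 2 ≤ 1 / (4 * L) := by
    have h1 : |w| ≤ a / 4 := by
      rw [abs_le]
      constructor <;> rw [hw] <;> linarith
    have h2 : w ^ 2 ≤ (a / 4) ^ 2 := by
      rw [← sq_abs]
      exact pow_le_pow_left₀ (abs_nonneg _) h1 2
    refine h2.trans (le_of_eq ?_)
    rw [ha, div_pow, div_pow, Real.sq_sqrt (by linarith)]
    field_simp
    norm_num
  have hq : 0 < 1 - 1 / (4 * L) := by
    have : 1 / (4 * L) ≤ 1 / 12 := one_div_le_one_div_of_le (by norm_num) (by linarith)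
    linarith
  have hcosh : sliceExponent L k * Real.cosh w ^ 2 ≤ sliceLevel L k := by
    have h1 : Real.cosh w ^ 2 ≤ Real.exp (1 / (4 * L)) := by
      have := pow_le_pow_left₀ (Real.cosh_pos w).le (Real.cosh_le_exp_half_sq w) 2
      rw [← Real.exp_nat_mul] at this
      refine this.trans (Real.exp_le_exp.mpr ?_)
      push_cast
      linarith
    have h2 : (1 - 1 / (4 * L)) * Real.exp (1 / (4 * L)) ≤ 1 := by
      have h3 := Real.add_one_le_exp (-(1 / (4 * L)))
      rw [Real.exp_neg] at h3
      calc (1 - 1 / (4 * L)) * Real.exp (1 / (4 * L))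
          ≤ (Real.exp (1 / (4 * L)))⁻¹ * Real.exp (1 / (4 * L)) := by
            refine mul_le_mul_of_nonneg_right ?_ (Real.exp_pos _).le
            linarith
        _ = 1 := inv_mul_cancel₀ (Real.exp_pos _).ne'
    calc sliceExponent L k * Real.cosh w ^ 2
        ≤ sliceExponent L k * Real.exp (1 / (4 * L)) := mul_le_mul_of_nonneg_left h1 hx.le
      _ = ((1 - 1 / (4 * L)) * Real.exp (1 / (4 * L))) * sliceLevel L k := by
          unfold sliceExponent
          ring
      _ ≤ 1 * sliceLevel L k := mul_le_mul_of_nonneg_right h2 hβ.le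
      _ = _ := one_mul _
  have h1v : 1 + v ^ 2 = 2 * v * Real.cosh w := by
    rw [Real.cosh_eq, Real.exp_neg, ← hv]
    field_simp
    ring
  have hl2 : sliceSlope L k ^ 2 * T / 2 = sliceExponent L k * v ^ 2 := by
    unfold sliceSlope
    rw [Real.sq_sqrt (by positivity), hv2, ← ha]
    ring
  have hlS : 2 * v * √(sliceExponent L k * sliceLevel L k) ≤ sliceSlope L k * S := by
    refine le_trans (le_of_eq ?_) (mul_le_mul_of_nonneg_left hS' (Real.sqrt_nonneg _))
    rw [sliceSlope, ← Real.sqrt_mul (by positivity), ← ha]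
    rw [show 2 * sliceExponent L k / Real.exp ((k + 1 / 2) * a) * (T * (2 * sliceLevel L k))
      = (2 * v) ^ 2 * (sliceExponent L k * sliceLevel L k) by rw [mul_pow, hv2]; ring]
    rw [Real.sqrt_mul (sq_nonneg (2 * v)), Real.sqrt_sq (by positivity)]
  have hkey : sliceExponent L k * Real.cosh w ≤ √(sliceExponent L k * sliceLevel L k) := by
    refine Real.le_sqrt_of_sq_le ?_
    calc (sliceExponent L k * Real.cosh w) ^ 2
        = sliceExponent L k * (sliceExponent L k * Real.cosh w ^ 2) := by ring
      _ ≤ _ := mul_le_mul_of_nonneg_left hcosh hx.le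
  rw [hl2]
  have h5 : sliceExponent L k * (1 + v ^ 2) ≤ 2 * v * √(sliceExponent L k * sliceLevel L k) := by
    rw [h1v]
    calc sliceExponent L k * (2 * v * Real.cosh w)
        = 2 * v * (sliceExponent L k * Real.cosh w) := by ring
      _ ≤ _ := mul_le_mul_of_nonneg_left hkey (by positivity)
  linarith

/-- A discrete integral test: (1+(k+1)a)^(-5/4) is at most 4/a times the decrement of (1+ka)^(-1/4),
so the sum telescopes. -/
theorem sum_exp_neg_log_le {a : ℝ} (ha : 0 < a) (n : ℕ) :
    ∑ k ∈ Finset.range n, Real.exp (-(5 / 4 * Real.log (1 + k * a))) ≤ 1 + 4 / a := by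
  set f : ℕ → ℝ := fun k => Real.exp (-(1 / 4 * Real.log (1 + k * a))) with hf
  have hstep : ∀ k : ℕ, Real.exp (-(5 / 4 * Real.log (1 + (k + 1 : ℕ) * a)))
      ≤ 4 / a * (f k - f (k + 1)) := by
    intro k
    set X : ℝ := 1 + k * a with hX
    have hX0 : 0 < X := by positivity
    have hY : 1 + ((k + 1 : ℕ) : ℝ) * a = X + a := by
      push_cast
      rw [hX]
      ring
    have hY0 : 0 < X + a := by positivity
    have hfk : f k = f (k + 1) * Real.exp ((Real.log (X + a) - Real.log X) / 4) := by
      simp only [hf]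
      rw [hY, ← Real.exp_add]
      congr 1
      ring
    have hlog : a / (X + a) ≤ Real.log (X + a) - Real.log X := by
      have := Real.log_le_sub_one_of_pos (div_pos hX0 hY0)
      rw [Real.log_div hX0.ne' hY0.ne'] at this
      have h2 : X / (X + a) = 1 - a / (X + a) := by
        field_simp
        ring
      linarith
    have hexp := Real.add_one_le_exp ((Real.log (X + a) - Real.log X) / 4)
    have hfp : 0 < f (k + 1) := Real.exp_pos _
    have hmain : f (k + 1) * (a / (X + a)) / 4 ≤ f k - f (k + 1) := by
      rw [hfk]
      nlinarith
    have hY5 : Real.exp (-(5 / 4 * Real.log (X + a))) = f (k + 1) / (X + a) := by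
      simp only [hf]
      rw [hY, eq_div_iff hY0.ne']
      nth_rw 2 [← Real.exp_log hY0]
      rw [← Real.exp_add]
      congr 1
      ring
    rw [hY, hY5]
    calc f (k + 1) / (X + a) = 4 / a * (f (k + 1) * (a / (X + a)) / 4) := by field_simp
      _ ≤ _ := mul_le_mul_of_nonneg_left hmain (by positivity)
  cases n with
  | zero => simp only [Finset.range_zero, Finset.sum_empty]; positivity
  | succ n =>
    rw [Finset.sum_range_succ']
    have h1 : ∑ k ∈ Finset.range n, Real.exp (-(5 / 4 * Real.log (1 + ((k + 1 : ℕ) : ℝ) * a)))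
        ≤ 4 / a * (f 0 - f n) := by
      rw [← Finset.sum_range_sub' f n, Finset.mul_sum]
      exact Finset.sum_le_sum fun k _ => hstep k
    have h2 : f 0 = 1 := by simp [hf]
    have h3 : 4 / a * (f 0 - f n) ≤ 4 / a := by
      have : 0 < f n := Real.exp_pos _
      rw [h2]
      exact mul_le_of_le_one_right (by positivity) (by linarith)
    have h4 : Real.exp (-(5 / 4 * Real.log (1 + ((0 : ℕ) : ℝ) * a))) = 1 := by simp
    linarith

/-- Since L ≥ 3, the factor 1 - 1/(4L) is at least 11/12. It costs 1/4 on the term L, turns 3 log L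
into at least (11/4) log L, and leaves at least 5/4 of the slice logarithm. The sum over slices
costs 1 + 2√L ≤ 3√L, so the total prefactor is 3 e^(1/4) L^(-9/4) ≤ 1/2. The half leaves room for
both tails. -/
theorem sum_exp_neg_sliceExponent_le {L : ℝ} (hL : 3 ≤ L) (n : ℕ) :
    ∑ k ∈ Finset.range n, Real.exp (-sliceExponent L k) ≤ Real.exp (-L) / 2 := by
  have hL0 : 0 < L := by linarith
  have hsq : 0 < √L := Real.sqrt_pos.mpr hL0
  have hlL : 0 ≤ Real.log L := Real.log_nonneg (by linarith)
  have hu : 1 / (4 * L) ≤ 1 / 12 := one_div_le_one_div_of_le (by norm_num) (by linarith)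
  have hterm : ∀ k : ℕ, Real.exp (-sliceExponent L k) ≤
      Real.exp (-L) * Real.exp (1 / 4 - 11 / 4 * Real.log L)
        * Real.exp (-(5 / 4 * Real.log (1 + k * (2 / √L)))) := by
    intro k
    rw [← Real.exp_add, ← Real.exp_add]
    refine Real.exp_le_exp.mpr ?_
    have h2 := log_one_add_natCast_mul_nonneg (a := 2 / √L) (by positivity) k
    have h3 : 1 / (4 * L) * L = 1 / 4 := by field_simp
    unfold sliceExponent sliceLevel
    nlinarith
  have hnum : Real.exp (1 / 4 - 11 / 4 * Real.log L) * (1 + 4 / (2 / √L)) ≤ 1 / 2 := by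
    have hs : √L = Real.exp (Real.log L / 2) := by
      rw [Real.exp_half, Real.exp_log hL0]
    have h1 : 1 + 4 / (2 / √L) ≤ 3 * Real.exp (Real.log L / 2) := by
      have : 1 ≤ Real.exp (Real.log L / 2) := Real.one_le_exp (by positivity)
      have h4 : 4 / (2 / √L) = 2 * √L := by
        field_simp
        norm_num
      rw [h4, hs]
      linarith
    have he : Real.exp (1 / 4) ≤ 3 / 2 := by
      have h4 : Real.exp (1 / 4) ^ 4 = Real.exp 1 := by
        rw [← Real.exp_nat_mul]
        norm_num
      by_contra hcon
      have h5 := pow_le_pow_left₀ (by norm_num) (not_le.mp hcon).le 4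
      rw [h4] at h5
      have := Real.exp_one_lt_d9
      norm_num at h5
      linarith
    have hL2 : Real.exp (-(2 * Real.log L)) ≤ 1 / 9 := by
      rw [Real.exp_neg, show 2 * Real.log L = ((2 : ℕ) : ℝ) * Real.log L by norm_num,
        Real.exp_nat_mul, Real.exp_log hL0, ← one_div]
      exact one_div_le_one_div_of_le (by norm_num) (by nlinarith)
    calc Real.exp (1 / 4 - 11 / 4 * Real.log L) * (1 + 4 / (2 / √L))
        ≤ Real.exp (1 / 4 - 11 / 4 * Real.log L) * (3 * Real.exp (Real.log L / 2)) :=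
          mul_le_mul_of_nonneg_left h1 (Real.exp_pos _).le
      _ = 3 * Real.exp (1 / 4 - 9 / 4 * Real.log L) := by
          rw [mul_left_comm, ← Real.exp_add]
          congr 2
          ring
      _ ≤ 3 * (Real.exp (1 / 4) * Real.exp (-(2 * Real.log L))) := by
          rw [← Real.exp_add]
          gcongr
          linarith
      _ ≤ 3 * (3 / 2 * (1 / 9)) := by
          gcongr
      _ = 1 / 2 := by norm_num
  calc ∑ k ∈ Finset.range n, Real.exp (-sliceExponent L k)
      ≤ ∑ k ∈ Finset.range n, Real.exp (-L) * Real.exp (1 / 4 - 11 / 4 * Real.log L)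
        * Real.exp (-(5 / 4 * Real.log (1 + k * (2 / √L)))) :=
        Finset.sum_le_sum fun k _ => hterm k
    _ = Real.exp (-L) * Real.exp (1 / 4 - 11 / 4 * Real.log L)
        * ∑ k ∈ Finset.range n, Real.exp (-(5 / 4 * Real.log (1 + k * (2 / √L)))) :=
        (Finset.mul_sum _ _ _).symm
    _ ≤ Real.exp (-L) * Real.exp (1 / 4 - 11 / 4 * Real.log L) * (1 + 4 / (2 / √L)) :=
        mul_le_mul_of_nonneg_left (sum_exp_neg_log_le (by positivity) n) (by positivity)
    _ = Real.exp (-L) * (Real.exp (1 / 4 - 11 / 4 * Real.log L) * (1 + 4 / (2 / √L))) :=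
        mul_assoc _ _ _
    _ ≤ Real.exp (-L) * (1 / 2) := mul_le_mul_of_nonneg_left hnum (Real.exp_pos _).le
    _ = _ := by ring

variable {Ω : Type*} {mΩ : MeasurableSpace Ω} {P : Measure Ω} [IsProbabilityMeasure P]

/-- A finite-time law of the iterated logarithm for sub-Gaussian random walks. -/
theorem measure_exists_iterated_log_lt_le {Y : ℕ → Ω → ℝ} (hY : ∀ i, Measurable (Y i))
    (hind : iIndepFun Y P) {s : NNReal} (hs : s ≤ 1) (hsub : ∀ i, HasSubgaussianMGF (Y i) s P)
    {L : ℝ} (hL : 3 ≤ L) :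
    P {ω | ∃ T : ℕ, 1 ≤ T ∧ √(T * (2 * L + 6 * Real.log L + 3 * Real.log (1 + Real.log T)))
        < ∑ i ∈ Finset.range T, Y i ω} ≤ ENNReal.ofReal (Real.exp (-L) / 2) := by
  calc P {ω | ∃ T : ℕ, 1 ≤ T ∧ √(T * (2 * L + 6 * Real.log L + 3 * Real.log (1 + Real.log T)))
        < ∑ i ∈ Finset.range T, Y i ω}
      ≤ P (⋃ k : ℕ, {ω | ∃ T : ℕ, 1 ≤ T ∧ sliceExponent L k
          ≤ sliceSlope L k * ∑ i ∈ Finset.range T, Y i ω - sliceSlope L k ^ 2 * T / 2}) := by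
        refine measure_mono ?_
        rintro ω ⟨T, hT, hlt⟩
        obtain ⟨k, hk⟩ := exists_slice_crossing hL (by exact_mod_cast hT) hlt
        exact Set.mem_iUnion.mpr ⟨k, T, hT, hk⟩
    _ ≤ ∑' k : ℕ, P {ω | ∃ T : ℕ, 1 ≤ T ∧ sliceExponent L k
          ≤ sliceSlope L k * ∑ i ∈ Finset.range T, Y i ω - sliceSlope L k ^ 2 * T / 2} :=
        measure_iUnion_le _
    _ ≤ ∑' k : ℕ, ENNReal.ofReal (Real.exp (-sliceExponent L k)) :=
        ENNReal.tsum_le_tsum fun k => measure_exists_line_crossing_le hY hind hs hsub _ _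
    _ ≤ ENNReal.ofReal (Real.exp (-L) / 2) := by
        refine ENNReal.tsum_le_of_sum_range_le fun n => ?_
        rw [← ENNReal.ofReal_sum_of_nonneg fun k _ => (Real.exp_pos _).le]
        exact ENNReal.ofReal_le_ofReal (sum_exp_neg_sliceExponent_le hL n)

end IteratedLogarithm

/-! ### Concentration in the random environment -/

section Environment

theorem natCast_mul_confWidth {T : ℕ} (hT : 1 ≤ T) (δ : ℝ) :
    T * confWidth T δ = √(T * (2 * Real.log (1 / δ) + 6 * Real.log (Real.log (1 / δ))
      + 3 * Real.log (1 + Real.log T))) := by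
  have hT0 : (0 : ℝ) < T := by exact_mod_cast hT
  rw [confWidth, Real.log_mul (Real.exp_pos 1).ne' hT0.ne', Real.log_exp]
  set B := 2 * Real.log (1 / δ) + 6 * Real.log (Real.log (1 / δ)) + 3 * Real.log (1 + Real.log T)
  rw [show (T : ℝ) * B = (T : ℝ) ^ 2 * (B / T) by field_simp, Real.sqrt_mul (sq_nonneg _),
    Real.sqrt_sq hT0.le]

/-- The confidence intervals of an arm of mean `m` with rewards `X` all contain `m`. -/
def ConfidenceValid (δ m : ℝ) (X : ℕ → ℝ) : Prop :=
  ∀ T : ℕ, 1 ≤ T → |(∑ i ∈ Finset.range T, X i) / T - m| ≤ confWidth T δ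

/-- The iterated-logarithm bound with L = log(1/δ) is applied to the centred walk and to its
negative, at cost δ/2 each. -/
theorem rewardKernel_not_confidenceValid_le (κ : Kernel ℝ ℝ) [IsMarkovKernel κ] {s : NNReal}
    (hs : s ≤ 1) {m : ℝ} (hsub : HasSubgaussianMGF (fun x => x - m) s (κ m)) {δ : ℝ} (hδ : 0 < δ)
    (hL : 3 ≤ Real.log (1 / δ)) :
    rewardKernel κ m {X | ¬ ConfidenceValid δ m X} ≤ ENNReal.ofReal δ := by
  change Measure.infinitePi (fun _ : ℕ => κ m) _ ≤ _
  set P := Measure.infinitePi (fun _ : ℕ => κ m)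
  have hind : iIndepFun (fun (i : ℕ) (X : ℕ → ℝ) => X i - m) P :=
    iIndepFun_infinitePi (P := fun _ : ℕ => κ m) (X := fun _ x => x - m) fun _ => by fun_prop
  have hsub1 : ∀ i : ℕ, HasSubgaussianMGF (fun X : ℕ → ℝ => X i - m) s P := fun i => by
    have h := hsub
    rw [← Measure.infinitePi_map_eval (fun _ : ℕ => κ m) i] at h
    exact h.of_map (measurable_pi_apply i : Measurable fun X : ℕ → ℝ => X i).aemeasurable
  have hind2 : iIndepFun (fun (i : ℕ) (X : ℕ → ℝ) => -(X i - m)) P :=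
    hind.comp (fun _ x => -x) fun _ => measurable_neg
  have hsub2 : ∀ i : ℕ, HasSubgaussianMGF (fun X : ℕ → ℝ => -(X i - m)) s P :=
    fun i => (hsub1 i).neg
  have h1 := measure_exists_iterated_log_lt_le (fun i => by fun_prop) hind hs hsub1 hL
  have h2 := measure_exists_iterated_log_lt_le (fun i => by fun_prop) hind2 hs hsub2 hL
  have hexp : Real.exp (-Real.log (1 / δ)) = δ := by
    rw [one_div, Real.log_inv, neg_neg, Real.exp_log hδ]
  rw [hexp] at h1 h2
  calc P {X | ¬ ConfidenceValid δ m X}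
      ≤ P ({X | ∃ T : ℕ, 1 ≤ T ∧ √(T * (2 * Real.log (1 / δ) + 6 * Real.log (Real.log (1 / δ))
            + 3 * Real.log (1 + Real.log T))) < ∑ i ∈ Finset.range T, (X i - m)} ∪
          {X | ∃ T : ℕ, 1 ≤ T ∧ √(T * (2 * Real.log (1 / δ) + 6 * Real.log (Real.log (1 / δ))
            + 3 * Real.log (1 + Real.log T))) < ∑ i ∈ Finset.range T, -(X i - m)}) := by
        refine measure_mono fun X hX => ?_
        have hX' : ¬ ConfidenceValid δ m X := hX
        unfold ConfidenceValid at hX'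
        push Not at hX'
        obtain ⟨T, hT, hlt⟩ := hX'
        have hT0 : (0 : ℝ) < T := by exact_mod_cast hT
        have hsum : ∑ i ∈ Finset.range T, (X i - m)
            = T * ((∑ i ∈ Finset.range T, X i) / T - m) := by
          rw [Finset.sum_sub_distrib]
          simp
          field_simp
        rcases lt_abs.mp hlt with h | h
        · refine Or.inl ⟨T, hT, ?_⟩
          rw [← natCast_mul_confWidth hT, hsum]
          exact mul_lt_mul_of_pos_left h hT0
        · refine Or.inr ⟨T, hT, ?_⟩
          rw [← natCast_mul_confWidth hT, Finset.sum_neg_distrib, hsum, ← mul_neg]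
          exact mul_lt_mul_of_pos_left h hT0
    _ ≤ ENNReal.ofReal (δ / 2) + ENNReal.ofReal (δ / 2) :=
        (measure_union_le _ _).trans (add_le_add h1 h2)
    _ = ENNReal.ofReal δ := by
        rw [← ENNReal.ofReal_add (by positivity) (by positivity), add_halves]

theorem measurableSet_not_confidenceValid (ν : Measure ℝ) (δ : ℝ) :
    MeasurableSet {p : ℝ × (ℕ → ℝ) | ¬ ConfidenceValid δ (quantile ν p.1) p.2} := by
  have hq := measurable_quantile ν
  suffices h : MeasurableSet {p : ℝ × (ℕ → ℝ) | ConfidenceValid δ (quantile ν p.1) p.2} from h.compl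
  have : {p : ℝ × (ℕ → ℝ) | ConfidenceValid δ (quantile ν p.1) p.2}
      = ⋂ T : ℕ, ⋂ _ : 1 ≤ T, {p : ℝ × (ℕ → ℝ) |
        |(∑ i ∈ Finset.range T, p.2 i) / T - quantile ν p.1| ≤ confWidth T δ} := by
    ext p
    simp [ConfidenceValid]
  rw [this]
  refine MeasurableSet.iInter fun T => MeasurableSet.iInter fun _ => ?_
  exact measurableSet_le (by fun_prop) measurable_const

theorem cdf_eq_zero_of_neg {ν : Measure ℝ} [IsProbabilityMeasure ν]
    (hν : ∀ᵐ m ∂ν, m ∈ Set.Icc (0 : ℝ) 1) {τ : ℝ} (hτ : τ < 0) : cdf ν τ = 0 := by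
  have : ν (Set.Iic τ) = 0 := by
    refine measure_mono_null ?_ hν
    intro x hx hx'
    exact absurd (hx'.1.trans hx) (not_le.mpr hτ)
  rw [cdf_eq_real, measureReal_def, this]
  rfl

theorem cdf_one_eq_one {ν : Measure ℝ} [IsProbabilityMeasure ν]
    (hν : ∀ᵐ m ∂ν, m ∈ Set.Icc (0 : ℝ) 1) : cdf ν 1 = 1 := by
  have : ν (Set.Iic 1) = 1 := by
    rw [← prob_compl_eq_zero_iff measurableSet_Iic]
    refine measure_mono_null ?_ hν
    intro x hx hx'
    exact hx hx'.2
  rw [cdf_eq_real, measureReal_def, this]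
  rfl

/-- For p outside (0,1] the defining set is everything or empty and `sInf` returns 0, which is still
a legitimate mean. Thus the sub-Gaussian assumption applies at every index, without an almost-sure
restriction. -/
theorem quantile_mem_Icc {ν : Measure ℝ} [IsProbabilityMeasure ν]
    (hν : ∀ᵐ m ∂ν, m ∈ Set.Icc (0 : ℝ) 1) (p : ℝ) : quantile ν p ∈ Set.Icc (0 : ℝ) 1 := by
  rcases le_or_gt p 0 with hp | hp
  · have : {τ : ℝ | p ≤ cdf ν τ} = Set.univ :=
      Set.eq_univ_of_forall fun τ => hp.trans (cdf_nonneg ν τ)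
    rw [quantile, this, Real.sInf_univ]
    exact ⟨le_rfl, zero_le_one⟩
  have hbd : ∀ τ ∈ {τ : ℝ | p ≤ cdf ν τ}, 0 ≤ τ := by
    intro τ hτ
    by_contra hcon
    have hτ' : p ≤ cdf ν τ := hτ
    rw [cdf_eq_zero_of_neg hν (not_le.mp hcon)] at hτ'
    linarith
  refine ⟨Real.sInf_nonneg hbd, ?_⟩
  rcases le_or_gt p 1 with hp1 | hp1
  · refine csInf_le ⟨0, hbd⟩ ?_
    change p ≤ cdf ν 1
    rwa [cdf_one_eq_one hν]
  · have : {τ : ℝ | p ≤ cdf ν τ} = ∅ :=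
      Set.eq_empty_of_forall_notMem fun τ hτ =>
        absurd (le_trans hτ (cdf_le_one ν τ)) (not_le.mpr hp1)
    rw [quantile, this, Real.sInf_empty]
    exact zero_le_one

theorem quantile_mono {ν : Measure ℝ} {p q : ℝ} (hp : 0 < p) (hpq : p ≤ q) (hq : q < 1) :
    quantile ν p ≤ quantile ν q := by
  rw [quantile_le_iff ν ⟨hp, hpq.trans_lt hq⟩]
  exact hpq.trans ((quantile_le_iff ν ⟨hp.trans_le hpq, hq⟩ _).mp le_rfl)

theorem ae_mem_Ioo_restrict_Icc :
    ∀ᵐ j ∂(volume.restrict (Set.Icc (0 : ℝ) 1)), j ∈ Set.Ioo (0 : ℝ) 1 := by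
  rw [← Measure.restrict_congr_set Ioo_ae_eq_Icc]
  exact ae_restrict_mem measurableSet_Ioo

theorem armLaw_not_confidenceValid_le (ν : Measure ℝ) [IsProbabilityMeasure ν] (κ : Kernel ℝ ℝ)
    [IsMarkovKernel κ] {s : NNReal} (hs : s ≤ 1) (hν : ∀ᵐ m ∂ν, m ∈ Set.Icc (0 : ℝ) 1)
    (hsub : ∀ m ∈ Set.Icc (0 : ℝ) 1, HasSubgaussianMGF (fun x => x - m) s (κ m)) {δ : ℝ}
    (hδ : 0 < δ) (hL : 3 ≤ Real.log (1 / δ)) :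
    armLaw ν κ {p | ¬ ConfidenceValid δ (quantile ν p.1) p.2} ≤ ENNReal.ofReal δ := by
  rw [armLaw, Measure.compProd_apply (measurableSet_not_confidenceValid ν δ)]
  calc _ ≤ ∫⁻ _, ENNReal.ofReal δ ∂(volume.restrict (Set.Icc (0 : ℝ) 1)) := by
        refine lintegral_mono fun j => ?_
        exact rewardKernel_not_confidenceValid_le κ hs (hsub _ (quantile_mem_Icc hν j)) hδ hL
    _ = ENNReal.ofReal δ := by simp

theorem armLaw_map_fst (ν : Measure ℝ) (κ : Kernel ℝ ℝ) [IsMarkovKernel κ] :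
    (armLaw ν κ).map Prod.fst = volume.restrict (Set.Icc (0 : ℝ) 1) :=
  Measure.fst_compProd _ _

variable {ι : Type*} [Fintype ι] {N : ℕ} (ν : ι → Measure ℝ) (κ : Kernel ℝ ℝ) [IsMarkovKernel κ]

instance : IsProbabilityMeasure (environment N ν κ) := by
  unfold environment
  infer_instance

theorem environment_preimage_eval (a : ι × Fin N) {A : Set (ℝ × (ℕ → ℝ))} (hA : MeasurableSet A) :
    environment N ν κ {ω | ω a ∈ A} = armLaw (ν a.1) κ A :=
  (measurePreserving_eval (fun a : ι × Fin N => armLaw (ν a.1) κ) a).measure_preimage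
    hA.nullMeasurableSet

theorem measurePreserving_index (a : ι × Fin N) :
    MeasurePreserving (fun ω : Outcome ι N => (ω a).1) (environment N ν κ)
      (volume.restrict (Set.Icc (0 : ℝ) 1)) := by
  have h1 : MeasurePreserving Prod.fst (armLaw (ν a.1) κ) (volume.restrict (Set.Icc (0 : ℝ) 1)) :=
    ⟨measurable_fst, armLaw_map_fst _ _⟩
  exact h1.comp (measurePreserving_eval (fun a : ι × Fin N => armLaw (ν a.1) κ) a)

theorem environment_exists_not_confidenceValid_le [∀ G, IsProbabilityMeasure (ν G)] {s : NNReal}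
    (hs : s ≤ 1) (hν : ∀ G, ∀ᵐ m ∂(ν G), m ∈ Set.Icc (0 : ℝ) 1)
    (hsub : ∀ m ∈ Set.Icc (0 : ℝ) 1, HasSubgaussianMGF (fun x => x - m) s (κ m)) {δ : ℝ}
    (hδ : 0 < δ) (hL : 3 ≤ Real.log (1 / δ)) :
    environment N ν κ {ω | ∃ G k, ¬ ConfidenceValid δ (quantile (ν G) (ω (G, k)).1) (ω (G, k)).2}
      ≤ ENNReal.ofReal ((N * Fintype.card ι : ℕ) * δ) := by
  calc _ ≤ environment N ν κ (⋃ a ∈ (Finset.univ : Finset (ι × Fin N)),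
          {ω | ω a ∈ {p | ¬ ConfidenceValid δ (quantile (ν a.1) p.1) p.2}}) := by
        refine measure_mono ?_
        rintro ω ⟨G, k, h⟩
        simp only [Set.mem_iUnion]
        exact ⟨(G, k), Finset.mem_univ _, h⟩
    _ ≤ ∑ a : ι × Fin N, environment N ν κ
          {ω | ω a ∈ {p | ¬ ConfidenceValid δ (quantile (ν a.1) p.1) p.2}} :=
        measure_biUnion_finset_le _ _
    _ ≤ ∑ _a : ι × Fin N, ENNReal.ofReal δ := by
        refine Finset.sum_le_sum fun a _ => ?_
        rw [environment_preimage_eval _ _ _ (measurableSet_not_confidenceValid _ _)]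
        exact armLaw_not_confidenceValid_le _ κ hs (hν _) hsub hδ hL
    _ = _ := by
        rw [Finset.sum_const, Finset.card_univ, Fintype.card_prod, Fintype.card_fin, mul_comm,
          ENNReal.ofReal_mul (by positivity), ENNReal.ofReal_natCast, nsmul_eq_mul]

/-- The end points have to be discarded because `quantile` is monotone only on (0,1). -/
theorem environment_index_notMem_Ioo :
    environment N ν κ {ω | ∃ G k, (ω (G, k)).1 ∉ Set.Ioo (0 : ℝ) 1} = 0 := by
  have : ∀ᵐ ω ∂(environment N ν κ), ∀ a : ι × Fin N, (ω a).1 ∈ Set.Ioo (0 : ℝ) 1 :=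
    ae_all_iff.mpr fun a =>
      (measurePreserving_index ν κ a).quasiMeasurePreserving.ae ae_mem_Ioo_restrict_Icc
  refine measure_mono_null ?_ this
  rintro ω ⟨G, k, h⟩ h'
  exact h (h' (G, k))

open Classical in
/-- **Hoeffding's inequality** for the number of arms whose index lies in a given set. -/
theorem environment_le_card_index_mem_le (G : ι) {A : Set ℝ} (hA : MeasurableSet A) {p s : ℝ}
    (hp : (volume.restrict (Set.Icc (0 : ℝ) 1)).real A ≤ p) (hs : 0 ≤ s) :
    environment N ν κ {ω | (p + s) * N ≤ (Finset.univ.filter fun k => (ω (G, k)).1 ∈ A).card}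
      ≤ ENNReal.ofReal (Real.exp (-(2 * N * s ^ 2))) := by
  set E := environment N ν κ
  set f : ℝ → ℝ := A.indicator 1 with hf
  have hfm : Measurable f := measurable_one.indicator hA
  set q := (volume.restrict (Set.Icc (0 : ℝ) 1)).real A with hq
  have hX : ∀ k : Fin N, Measurable fun ω : Outcome ι N => f (ω (G, k)).1 := fun k => by fun_prop
  have hmean : ∀ k : Fin N, ∫ ω, f (ω (G, k)).1 ∂E = q := fun k => by
    have hP := measurePreserving_index ν κ (G, k)
    have h := integral_map (μ := environment N ν κ) (f := f) hP.measurable.aemeasurable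
      hfm.aestronglyMeasurable
    rw [hP.map_eq] at h
    exact h.symm.trans (integral_indicator_one hA)
  have hind : iIndepFun (fun (k : Fin N) (ω : Outcome ι N) => f (ω (G, k)).1 - q) E := by
    have h := iIndepFun_pi (μ := fun a : ι × Fin N => armLaw (ν a.1) κ)
      (X := fun (_ : ι × Fin N) (p : ℝ × (ℕ → ℝ)) => f p.1 - q)
      fun a => ((hfm.comp measurable_fst).sub_const q).aemeasurable
    exact h.precomp (g := fun k : Fin N => (G, k)) (Prod.mk_right_injective G)
  -- Indicators lie in [0,1], so Hoeffding's lemma gives the parameter 1/4 and hence the exponent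
  -- 2Ns².
  have hsub : ∀ k ∈ (Finset.univ : Finset (Fin N)),
      HasSubgaussianMGF (fun ω : Outcome ι N => f (ω (G, k)).1 - q) ((‖(1 : ℝ) - 0‖₊ / 2) ^ 2) E := by
    intro k _
    rw [← hmean k]
    refine hasSubgaussianMGF_of_mem_Icc (hX k).aemeasurable (ae_of_all _ fun ω => ?_)
    rw [hf]
    by_cases h : (ω (G, k)).1 ∈ A <;> simp [h]
  have hH := HasSubgaussianMGF.measure_sum_ge_le_of_iIndepFun hind hsub
    (ε := s * N) (by positivity)
  have hexp : -(s * N) ^ 2 / (2 * ((∑ _k : Fin N, (‖(1 : ℝ) - 0‖₊ / 2) ^ 2 : NNReal) : ℝ))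
      = -(2 * N * s ^ 2) := by
    rcases Nat.eq_zero_or_pos N with hN | hN
    · subst hN; simp
    · have : (N : ℝ) ≠ 0 := by positivity
      simp
      field_simp
  rw [hexp, measureReal_def] at hH
  refine le_trans (measure_mono fun ω hω => ?_)
    ((ENNReal.le_ofReal_iff_toReal_le (measure_ne_top _ _) (Real.exp_pos _).le).mpr hH)
  have hω' : (p + s) * N ≤ (Finset.univ.filter fun k => (ω (G, k)).1 ∈ A).card := hω
  change s * N ≤ ∑ k, (f (ω (G, k)).1 - q)
  have hsum : ∑ k, f (ω (G, k)).1 = (Finset.univ.filter fun k => (ω (G, k)).1 ∈ A).card := by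
    simp [hf, Set.indicator_apply]
  rw [Finset.sum_sub_distrib, hsum]
  simp only [Finset.sum_const, Finset.card_univ, Fintype.card_fin, nsmul_eq_mul]
  have : q * N ≤ p * N := mul_le_mul_of_nonneg_right hp (Nat.cast_nonneg N)
  linarith

end Environment

/-! ### Quantiles of finite samples -/

section EmpQuantile

variable {N : ℕ} {p : ℝ}

theorem empQuantile_le_iff (hN : 0 < N) (hp : p ∈ Set.Ioo (0 : ℝ) 1) (x : Fin N → ℝ) (τ : ℝ) :
    empQuantile p x ≤ τ ↔ p * N ≤ (Finset.univ.filter fun k => x k ≤ τ).card := by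
  have hN0 : (0 : ℝ) < N := by exact_mod_cast hN
  have hS : ∀ σ : ℝ, σ ∈ {τ : ℝ | p ≤ ((Finset.univ.filter fun k => x k ≤ τ).card : ℝ) / N}
      ↔ p * N ≤ (Finset.univ.filter fun k => x k ≤ σ).card := fun σ => le_div_iff₀ hN0
  have hbound : ∀ k, |x k| ≤ ∑ k, |x k| := fun k =>
    Finset.single_le_sum (f := fun k => |x k|) (fun i _ => abs_nonneg _) (Finset.mem_univ k)
  have hne : {τ : ℝ | p ≤ ((Finset.univ.filter fun k => x k ≤ τ).card : ℝ) / N}.Nonempty := by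
    refine ⟨∑ k, |x k|, (hS _).mpr ?_⟩
    rw [Finset.filter_true_of_mem fun k _ => (le_abs_self _).trans (hbound k)]
    simp only [Finset.card_univ, Fintype.card_fin]
    nlinarith [hp.2]
  have hmem : ∀ σ ∈ {τ : ℝ | p ≤ ((Finset.univ.filter fun k => x k ≤ τ).card : ℝ) / N},
      ∃ k, x k ≤ σ := by
    intro σ hσ
    rw [hS] at hσ
    have hpos : (0 : ℝ) < (Finset.univ.filter fun k => x k ≤ σ).card :=
      lt_of_lt_of_le (mul_pos hp.1 hN0) hσ
    obtain ⟨k, hk⟩ := Finset.card_pos.mp (by exact_mod_cast hpos)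
    exact ⟨k, (Finset.mem_filter.mp hk).2⟩
  have hbd : BddBelow {τ : ℝ | p ≤ ((Finset.univ.filter fun k => x k ≤ τ).card : ℝ) / N} := by
    refine ⟨-∑ k, |x k|, fun σ hσ => ?_⟩
    obtain ⟨k, hk⟩ := hmem σ hσ
    linarith [neg_abs_le (x k), hbound k]
  constructor
  · intro h
    by_contra hcon
    have hex : (Finset.univ.filter fun k => τ < x k).Nonempty := by
      by_contra hempty
      refine hcon ?_
      rw [Finset.not_nonempty_iff_eq_empty, Finset.filter_eq_empty_iff] at hempty
      rw [Finset.filter_true_of_mem fun k hk => not_lt.mp (hempty hk)]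
      simp only [Finset.card_univ, Fintype.card_fin]
      nlinarith [hp.2]
    -- The counting function is constant from τ up to the next sample value, so the infimum cannot
    -- be smaller than that value.
    obtain ⟨k₀, hk₀, hmin⟩ := Finset.exists_min_image _ x hex
    have hk₀' : τ < x k₀ := (Finset.mem_filter.mp hk₀).2
    have hlow : x k₀ ≤ empQuantile p x := by
      refine le_csInf hne fun σ hσ => ?_
      by_contra hlt
      rw [hS] at hσ
      refine hcon (hσ.trans ?_)
      refine Nat.cast_le.mpr (Finset.card_le_card fun k hk => ?_)
      rw [Finset.mem_filter] at hk ⊢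
      refine ⟨hk.1, ?_⟩
      by_contra hk'
      exact hlt ((hmin k (Finset.mem_filter.mpr ⟨hk.1, not_le.mp hk'⟩)).trans hk.2)
    linarith
  · intro h
    exact csInf_le hbd ((hS τ).mpr h)

theorem empQuantile_mono (hN : 0 < N) (hp : p ∈ Set.Ioo (0 : ℝ) 1) {x y : Fin N → ℝ}
    (hxy : ∀ k, x k ≤ y k) : empQuantile p x ≤ empQuantile p y := by
  rw [empQuantile_le_iff hN hp]
  refine ((empQuantile_le_iff hN hp y _).mp le_rfl).trans (Nat.cast_le.mpr ?_)
  refine Finset.card_le_card fun k hk => ?_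
  rw [Finset.mem_filter] at hk ⊢
  exact ⟨hk.1, (hxy k).trans hk.2⟩

theorem empQuantile_lt_of_le_card (hN : 0 < N) (hp : p ∈ Set.Ioo (0 : ℝ) 1) {x : Fin N → ℝ}
    {y : ℝ} (h : p * N ≤ (Finset.univ.filter fun k => x k < y).card) : empQuantile p x < y := by
  have hpos : (0 : ℝ) < (Finset.univ.filter fun k => x k < y).card :=
    lt_of_lt_of_le (mul_pos hp.1 (by exact_mod_cast hN)) h
  obtain ⟨k₀, hk₀, hmax⟩ := Finset.exists_max_image _ x
    (Finset.card_pos.mp (by exact_mod_cast hpos : 0 < (Finset.univ.filter fun k => x k < y).card))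
  refine lt_of_le_of_lt ?_ (Finset.mem_filter.mp hk₀).2
  rw [empQuantile_le_iff hN hp]
  refine h.trans (Nat.cast_le.mpr (Finset.card_le_card fun k hk => ?_))
  exact Finset.mem_filter.mpr ⟨Finset.mem_univ _, hmax k hk⟩

end EmpQuantile

/-! ### Deterministic analysis of the elimination loop -/

section Algorithm

variable {ι : Type*} [Fintype ι] {N : ℕ}

/-- The confidence width of an arm after `T` pulls. -/
noncomputable def armWidth (ι : Type*) [Fintype ι] (N : ℕ) (δ : ℝ) (T : ℕ) : ℝ :=
  confWidth T (δ / (N * Fintype.card ι : ℕ))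

/-- The `(1 - α)`-quantile of the means of the arms of a group. -/
noncomputable def armQuantile (α : ℝ) (μ : ι → Fin N → ℝ) (G : ι) : ℝ := empQuantile (1 - α) (μ G)

/-- What relates the memory to the rewards `x` and the means `μ` after `t` rounds. -/
structure Consistent (α δ : ℝ) (x : ℕ → ι → Fin N → ℝ) (μ : ι → Fin N → ℝ) (t : ℕ)
    (st : Memory ι N) : Prop where
  pulls_eq : ∀ G ∈ st.cand, ∀ k ∈ st.pot G, st.pulls G k = t
  total_eq : ∀ G k, st.total G k = ∑ i ∈ Finset.range (st.pulls G k), x i G k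
  pos_or_active : ∀ G k, 1 ≤ st.pulls G k ∨ st.Active G k
  dropped : ∀ G ∈ st.cand, ∀ k ∉ st.pot G,
    armQuantile α μ G < st.lcb δ G k ∨ st.ucb δ G k < armQuantile α μ G

variable {α Δ δ : ℝ} {x : ℕ → ι → Fin N → ℝ} {μ : ι → Fin N → ℝ} {t : ℕ} {st : Memory ι N}

theorem consistent_init : Consistent α δ x μ 0 (Memory.init ι N) where
  pulls_eq _ _ _ _ := rfl
  total_eq _ _ := by simp [Memory.init]
  pos_or_active G k := Or.inr ⟨Finset.mem_univ G, Finset.mem_univ k⟩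
  dropped _ _ k hk := absurd (Finset.mem_univ k) hk

theorem ucb_eq_lcb_add (G : ι) (k : Fin N) :
    st.ucb δ G k = st.lcb δ G k + 2 * armWidth ι N δ (st.pulls G k) := by
  unfold Memory.ucb Memory.lcb armWidth
  ring

theorem mem_cand_eliminate {G : ι} : G ∈ (st.eliminate α δ).cand ↔
    G ∈ st.cand ∧ ∀ G' ∈ st.cand, st.lcbQuantile α δ G' ≤ st.ucbQuantile α δ G := by
  simp [Memory.eliminate]

theorem mem_pot_eliminate {G : ι} {k : Fin N} : k ∈ (st.eliminate α δ).pot G ↔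
    k ∈ st.pot G ∧ st.lcb δ G k ≤ st.ucbQuantile α δ G ∧ st.lcbQuantile α δ G ≤ st.ucb δ G k := by
  simp [Memory.eliminate]

namespace Consistent

theorem mem_confidence (h : Consistent α δ x μ t st)
    (hv : ∀ G k, ConfidenceValid (δ / (N * Fintype.card ι : ℕ)) (μ G k) fun i => x i G k)
    {G : ι} {k : Fin N} (hpos : 1 ≤ st.pulls G k) :
    st.lcb δ G k ≤ μ G k ∧ μ G k ≤ st.ucb δ G k := by
  have h1 := abs_le.mp (hv G k (st.pulls G k) hpos)
  unfold Memory.lcb Memory.ucb Memory.empMean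
  rw [h.total_eq]
  constructor <;> linarith [h1.1, h1.2]

theorem pull (h : Consistent α δ x μ t st) :
    Consistent α δ x μ (t + 1) (st.pull (x t)) where
  pulls_eq G hG k hk := by
    have ha : st.Active G k := ⟨hG, hk⟩
    simp [Memory.pull, ha, h.pulls_eq G hG k hk]
  total_eq G k := by
    by_cases ha : st.Active G k
    · simp only [Memory.pull, ha, if_true]
      rw [Finset.sum_range_succ, ← h.total_eq, h.pulls_eq G ha.1 k ha.2]
    · simp only [Memory.pull, ha, if_false]
      exact h.total_eq G k
  pos_or_active G k := by
    by_cases ha : st.Active G k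
    · exact Or.inr ha
    · exact Or.inl (by simpa [Memory.pull, ha] using (h.pos_or_active G k).resolve_right ha)
  dropped G hG k hk := by
    have ha : ¬ st.Active G k := fun ha => hk ha.2
    simpa [Memory.pull, Memory.lcb, Memory.ucb, Memory.empMean, ha] using h.dropped G hG k hk

theorem one_le_pulls_pull (h : Consistent α δ x μ t st) (G : ι) (k : Fin N) :
    1 ≤ (st.pull (x t)).pulls G k := by
  by_cases ha : st.Active G k
  · simp [Memory.pull, ha]
  · simpa [Memory.pull, ha] using (h.pos_or_active G k).resolve_right ha

variable (hN : 0 < N) (hα : α ∈ Set.Ioo (0 : ℝ) 1)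
  (hv : ∀ G k, ConfidenceValid (δ / (N * Fintype.card ι : ℕ)) (μ G k) fun i => x i G k)

include hN hα hv

theorem lcbQuantile_le (h : Consistent α δ x μ t st) (hpos : ∀ G k, 1 ≤ st.pulls G k) (G : ι) :
    st.lcbQuantile α δ G ≤ armQuantile α μ G :=
  empQuantile_mono hN ⟨by linarith [hα.2], by linarith [hα.1]⟩
    fun k => (h.mem_confidence hv (hpos G k)).1

theorem le_ucbQuantile (h : Consistent α δ x μ t st) (hpos : ∀ G k, 1 ≤ st.pulls G k) (G : ι) :
    armQuantile α μ G ≤ st.ucbQuantile α δ G :=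
  empQuantile_mono hN ⟨by linarith [hα.2], by linarith [hα.1]⟩
    fun k => (h.mem_confidence hv (hpos G k)).2

/-- Every arm with mean at most q_G must have an upper bound at most q_G + 2W. An arm still in play
has been pulled t times, so its interval has length 2W. The interval of an eliminated arm may be
wider, but it avoids q_G and contains the mean, hence lies wholly below q_G. -/
theorem ucbQuantile_le (h : Consistent α δ x μ t st) (hpos : ∀ G k, 1 ≤ st.pulls G k) {G : ι}
    (hG : G ∈ st.cand) : st.ucbQuantile α δ G ≤ armQuantile α μ G + 2 * armWidth ι N δ t := by
  have hp : 1 - α ∈ Set.Ioo (0 : ℝ) 1 := ⟨by linarith [hα.2], by linarith [hα.1]⟩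
  have hW : 0 ≤ armWidth ι N δ t := Real.sqrt_nonneg _
  rw [Memory.ucbQuantile, empQuantile_le_iff hN hp]
  refine ((empQuantile_le_iff hN hp (μ G) _).mp (le_refl (armQuantile α μ G))).trans
    (Nat.cast_le.mpr (Finset.card_le_card fun k hk => ?_))
  rw [Finset.mem_filter] at hk ⊢
  refine ⟨hk.1, ?_⟩
  have hc := h.mem_confidence hv (hpos G k)
  by_cases hpot : k ∈ st.pot G
  · have h1 := ucb_eq_lcb_add (δ := δ) (st := st) G k
    rw [h.pulls_eq G hG k hpot] at h1
    linarith [hc.1, hk.2]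
  · rcases h.dropped G hG k hpot with h1 | h1 <;> linarith [hc.1, hk.2]

theorem le_lcbQuantile (h : Consistent α δ x μ t st) (hpos : ∀ G k, 1 ≤ st.pulls G k) {G : ι}
    (hG : G ∈ st.cand) : armQuantile α μ G - 2 * armWidth ι N δ t ≤ st.lcbQuantile α δ G := by
  have hp : 1 - α ∈ Set.Ioo (0 : ℝ) 1 := ⟨by linarith [hα.2], by linarith [hα.1]⟩
  have hW : 0 ≤ armWidth ι N δ t := Real.sqrt_nonneg _
  by_contra hcon
  refine lt_irrefl (armQuantile α μ G) (empQuantile_lt_of_le_card hN hp ?_)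
  refine ((empQuantile_le_iff hN hp (st.lcb δ G) _).mp (le_refl (st.lcbQuantile α δ G))).trans
    (Nat.cast_le.mpr (Finset.card_le_card fun k hk => ?_))
  rw [Finset.mem_filter] at hk ⊢
  refine ⟨hk.1, ?_⟩
  have hc := h.mem_confidence hv (hpos G k)
  by_cases hpot : k ∈ st.pot G
  · have h1 := ucb_eq_lcb_add (δ := δ) (st := st) G k
    rw [h.pulls_eq G hG k hpot] at h1
    linarith [hc.2, hk.2]
  · rcases h.dropped G hG k hpot with h1 | h1 <;> linarith [hc.2, hk.2]

/-- Valid intervals give LQ ≤ q_G ≤ UQ, so an arm excluded by UQ or LQ has its interval strictly on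
one side of q_G. It is not pulled afterwards, so this persists. -/
theorem eliminate (h : Consistent α δ x μ t st) (hpos : ∀ G k, 1 ≤ st.pulls G k) :
    Consistent α δ x μ t (st.eliminate α δ) where
  pulls_eq G hG k hk := h.pulls_eq G (mem_cand_eliminate.mp hG).1 k (mem_pot_eliminate.mp hk).1
  total_eq := h.total_eq
  pos_or_active G k := Or.inl (hpos G k)
  dropped G hG k hk := by
    have hG' : G ∈ st.cand := (mem_cand_eliminate.mp hG).1
    change armQuantile α μ G < st.lcb δ G k ∨ st.ucb δ G k < armQuantile α μ G
    by_cases hpot : k ∈ st.pot G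
    · by_contra hcon
      push Not at hcon
      refine hk (mem_pot_eliminate.mpr ⟨hpot, ?_, ?_⟩)
      · exact hcon.1.trans (h.le_ucbQuantile hN hα hv hpos G)
      · exact (h.lcbQuantile_le hN hα hv hpos G).trans hcon.2
    · exact h.dropped G hG' k hpot

end Consistent

/-- What a pull of arm `k` of group `G` in round `s + 1` reveals about the arm, where `Gs` is any
fixed group. -/
def Unresolved (α Δ δ : ℝ) (μ : ι → Fin N → ℝ) (Gs G : ι) (k : Fin N) (s : ℕ) : Prop :=
  Δ < 4 * armWidth ι N δ s ∧
  (∃ G₁, G₁ ≠ Gs ∧ ∀ G', armQuantile α μ G' ≤ armQuantile α μ G₁ + 4 * armWidth ι N δ s) ∧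
  (∀ G', armQuantile α μ G' ≤ armQuantile α μ G + 4 * armWidth ι N δ s) ∧
  |μ G k - armQuantile α μ G| ≤ 4 * armWidth ι N δ s

/-- The invariant of the while-loop. -/
structure Invariant (α Δ δ : ℝ) (x : ℕ → ι → Fin N → ℝ) (μ : ι → Fin N → ℝ) (Gs : ι) (t : ℕ)
    (st : Memory ι N) : Prop extends Consistent α δ x μ t st where
  one_le_pulls : 1 ≤ t → ∀ G k, 1 ≤ st.pulls G k
  best_mem : ∀ G, (∀ G', armQuantile α μ G' ≤ armQuantile α μ G) → G ∈ st.cand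
  cand_near : 1 ≤ t → ∀ G ∈ st.cand, ∀ G',
    armQuantile α μ G' ≤ armQuantile α μ G + 4 * armWidth ι N δ t
  pot_near : 1 ≤ t → ∀ G ∈ st.cand, ∀ k ∈ st.pot G,
    |μ G k - armQuantile α μ G| ≤ 4 * armWidth ι N δ t
  width_eq : 1 ≤ t → st.width = ((sSup (st.ucbQuantile α δ '' (st.cand : Set ι))
      - sSup (st.lcbQuantile α δ '' (st.cand : Set ι)) : ℝ) : EReal)
  history : ∀ G k s, 1 ≤ s → st.pulls G k = s + 1 → Unresolved α Δ δ μ Gs G k s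

theorem invariant_init (Gs : ι) : Invariant α Δ δ x μ Gs 0 (Memory.init ι N) where
  toConsistent := consistent_init
  one_le_pulls h := by omega
  best_mem G _ := Finset.mem_univ G
  cand_near h := by omega
  pot_near h := by omega
  width_eq h := by omega
  history G k s hs h := by simp [Memory.init] at h

namespace Invariant

variable {Gs : ι} (hN : 0 < N) (hα : α ∈ Set.Ioo (0 : ℝ) 1)
  (hv : ∀ G k, ConfidenceValid (δ / (N * Fintype.card ι : ℕ)) (μ G k) fun i => x i G k)

theorem exists_best_mem [Nonempty ι] (h : Invariant α Δ δ x μ Gs t st) :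
    ∃ G ∈ st.cand, ∀ G', armQuantile α μ G' ≤ armQuantile α μ G := by
  obtain ⟨G, hG⟩ := Finite.exists_max (armQuantile α μ)
  exact ⟨G, h.best_mem G hG, hG⟩

include hN hα hv

/-- With q the largest group quantile, the maximal UQ is at most q + 2W. A best group is still a
candidate, so the maximal LQ is at least q - 2W. -/
theorem lt_four_mul_armWidth [Nonempty ι] (h : Invariant α Δ δ x μ Gs t st) (ht : 1 ≤ t)
    (hrun : st.Running Δ) : Δ < 4 * armWidth ι N δ t := by
  have hw := hrun.2
  rw [h.width_eq ht, EReal.coe_lt_coe_iff] at hw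
  have hpos := h.one_le_pulls ht
  obtain ⟨G, hG, hbest⟩ := h.exists_best_mem
  have hU : sSup (st.ucbQuantile α δ '' (st.cand : Set ι))
      ≤ armQuantile α μ G + 2 * armWidth ι N δ t := by
    refine csSup_le (Set.Nonempty.image _ ⟨G, hG⟩) ?_
    rintro _ ⟨G', hG', rfl⟩
    linarith [h.ucbQuantile_le hN hα hv hpos hG', hbest G']
  have hLq : armQuantile α μ G - 2 * armWidth ι N δ t
      ≤ sSup (st.lcbQuantile α δ '' (st.cand : Set ι)) :=
    (h.le_lcbQuantile hN hα hv hpos hG).trans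
      (le_csSup ((Set.toFinite _).bddAbove) (Set.mem_image_of_mem _ hG))
  linarith

/-- Each survival test compares quantities that are off by at most 2W from the truth, so passing it
certifies closeness up to 4W. For `history`, the pull numbered s+1 was made because the state after
s rounds allowed it; hence the width there is the one at s, and s ≥ 1 is needed for bounds to exist.
-/
theorem step [Nonempty ι] (h : Invariant α Δ δ x μ Gs t st) (hrun : st.Running Δ) :
    Invariant α Δ δ x μ Gs (t + 1) ((st.pull (x t)).eliminate α δ) := by
  have hc := h.toConsistent.pull
  have hpos := h.toConsistent.one_le_pulls_pull
  obtain ⟨G₀, hG₀, hbest₀⟩ := h.exists_best_mem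
  refine ⟨hc.eliminate hN hα hv hpos, fun _ => hpos, ?_, ?_, ?_, fun _ => rfl, ?_⟩
  · intro G hG
    refine mem_cand_eliminate.mpr ⟨h.best_mem G hG, fun G' _ => ?_⟩
    exact (hc.lcbQuantile_le hN hα hv hpos G').trans
      ((hG G').trans (hc.le_ucbQuantile hN hα hv hpos G))
  · intro _ G hG G'
    have hG' := mem_cand_eliminate.mp hG
    have h1 := hG'.2 G₀ hG₀
    have h2 := hc.le_lcbQuantile hN hα hv hpos hG₀
    have h3 := hc.ucbQuantile_le hN hα hv hpos hG'.1
    linarith [hbest₀ G']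
  · intro _ G hG k hk
    have hG' := mem_cand_eliminate.mp hG
    have hk' := mem_pot_eliminate.mp hk
    have h2 := hc.le_lcbQuantile hN hα hv hpos hG'.1
    have h3 := hc.ucbQuantile_le hN hα hv hpos hG'.1
    have h4 := hc.mem_confidence hv (hpos G k)
    have h5 := ucb_eq_lcb_add (δ := δ) (st := st.pull (x t)) G k
    rw [hc.pulls_eq G hG'.1 k hk'.1] at h5
    rw [abs_le]
    constructor <;> linarith [hk'.2.1, hk'.2.2]
  · intro G k s hs hp
    have hp' : (st.pull (x t)).pulls G k = s + 1 := hp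
    by_cases ha : st.Active G k
    · simp only [Memory.pull, ha, if_true] at hp'
      rw [h.pulls_eq G ha.1 k ha.2] at hp'
      obtain rfl : t = s := by omega
      -- A running loop has two candidates, so one differs from `Gs`; it is the witness for Δ̃₀.
      obtain ⟨G₁, hG₁, hne⟩ := Finset.exists_mem_ne hrun.1 Gs
      exact ⟨h.lt_four_mul_armWidth hN hα hv hs hrun, ⟨G₁, hne, h.cand_near hs G₁ hG₁⟩,
        h.cand_near hs G ha.1, h.pot_near hs G ha.1 k ha.2⟩
    · simp only [Memory.pull, ha, if_false] at hp'
      exact h.history G k s hs hp'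

/-- There are two ways out of the loop. If the width is at most Δ, the largest LQ is within Δ of the
best UQ. If a single candidate is left, it is a best group, since such a group is never eliminated.
-/
theorem le_of_mayReturn [Nonempty ι] (h : Invariant α Δ δ x μ Gs t st) (ht : 1 ≤ t)
    (hΔ : 0 ≤ Δ) (hrun : ¬ st.Running Δ) {G : ι} (hG : st.MayReturn α δ G) (G' : ι) :
    armQuantile α μ G' - Δ ≤ armQuantile α μ G := by
  have hpos := h.one_le_pulls ht
  obtain ⟨G₀, hG₀, hbest⟩ := h.exists_best_mem
  by_cases hcard : 1 < st.cand.card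
  · have hw : ¬ (Δ : EReal) < st.width := fun hw => hrun ⟨hcard, hw⟩
    rw [h.width_eq ht, EReal.coe_lt_coe_iff, not_lt] at hw
    have hU : armQuantile α μ G₀ ≤ sSup (st.ucbQuantile α δ '' (st.cand : Set ι)) :=
      (h.le_ucbQuantile hN hα hv hpos G₀).trans
        (le_csSup ((Set.toFinite _).bddAbove) (Set.mem_image_of_mem _ hG₀))
    have hLq : sSup (st.lcbQuantile α δ '' (st.cand : Set ι)) ≤ armQuantile α μ G := by
      refine csSup_le (Set.Nonempty.image _ ⟨G, hG.1⟩) ?_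
      rintro _ ⟨G', hG', rfl⟩
      exact (hG.2 G' hG').trans (h.lcbQuantile_le hN hα hv hpos G)
    linarith [hbest G']
  · have : G = G₀ := Finset.card_le_one.mp (not_lt.mp hcard) G hG.1 G₀ hG₀
    rw [this]
    linarith [hbest G']

omit hN hα hv in
theorem exists_mayReturn [Nonempty ι] (h : Invariant α Δ δ x μ Gs t st) :
    ∃ G, st.MayReturn α δ G := by
  obtain ⟨G₀, hG₀, -⟩ := h.exists_best_mem
  obtain ⟨G, hG, hmax⟩ := Finset.exists_max_image st.cand (st.lcbQuantile α δ) ⟨G₀, hG₀⟩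
  exact ⟨G, hG, hmax⟩

end Invariant

theorem invariant_run [Nonempty ι] (Gs : ι) (hN : 0 < N) (hα : α ∈ Set.Ioo (0 : ℝ) 1)
    (hv : ∀ G k, ConfidenceValid (δ / (N * Fintype.card ι : ℕ)) (μ G k) fun i => x i G k)
    (t : ℕ) (hrun : ∀ s < t, (Memory.run α Δ δ x s).Running Δ) :
    Invariant α Δ δ x μ Gs t (Memory.run α Δ δ x t) := by
  induction t with
  | zero => exact invariant_init Gs
  | succ t ih =>
    have h := hrun t (Nat.lt_succ_self t)
    simp only [Memory.run, h, if_true]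
    exact (ih fun s hs => hrun s (hs.trans (Nat.lt_succ_self t))).step hN hα hv h

end Algorithm

/-! ### Solving the confidence width for the number of pulls -/

section Inversion

theorem log_le_div_add_four {y : ℝ} (hy : 0 < y) : Real.log y ≤ y / 96 + 4 := by
  have h1 := Real.log_le_sub_one_of_pos (div_pos hy (by norm_num : (0 : ℝ) < 96))
  rw [Real.log_div hy.ne' (by norm_num)] at h1
  have h2 : Real.log 96 ≤ 5 := by
    rw [Real.log_le_iff_le_exp (by norm_num)]
    have h3 : (2.7 : ℝ) ^ 5 ≤ Real.exp 1 ^ 5 :=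
      pow_le_pow_left₀ (by norm_num) (by linarith [Real.exp_one_gt_d9]) 5
    rw [← Real.exp_nat_mul] at h3
    norm_num at h3 ⊢
    linarith
  linarith

/-- Squaring gives t ≤ (16/g²)(8L + 3 log(1 + log t)). With y = g²t, the iterated logarithm is at
most 1 + log m + log y, and the term 48 log y is at most y/2 + 192. This leaves y ≤ 256L + 480 + 96
log m, and 480 ≤ 160L produces the constant 416. -/
theorem le_of_le_four_mul_confWidth {δ g : ℝ} {t : ℕ} (hL : 3 ≤ Real.log (1 / δ))
    (ht : 1 ≤ t) (hg : 0 < g) (h : g ≤ 4 * confWidth t δ) :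
    (t : ℝ) ≤ 416 / g ^ 2 * (Real.log (1 / δ) + Real.log (max 1 (Real.log (1 / g ^ 2)))) := by
  set L := Real.log (1 / δ) with hLdef
  set A : ℝ := 1 / g ^ 2 with hA
  set m : ℝ := max 1 (Real.log A) with hm
  have hA0 : 0 < A := by positivity
  have hm1 : 1 ≤ m := le_max_left _ _
  have hlm : 0 ≤ Real.log m := Real.log_nonneg hm1
  have ht0 : (1 : ℝ) ≤ t := by exact_mod_cast ht
  have htpos : (0 : ℝ) < t := by linarith
  have hlt : 0 ≤ Real.log t := Real.log_nonneg ht0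
  have hlL : 0 ≤ Real.log L := Real.log_nonneg (by linarith)
  have hlL2 : Real.log L ≤ L := (Real.log_le_sub_one_of_pos (by linarith)).trans (by linarith)
  have hll : 0 ≤ Real.log (1 + Real.log t) := Real.log_nonneg (by linarith)
  have hsq : (t * confWidth t δ) ^ 2
      = t * (2 * L + 6 * Real.log L + 3 * Real.log (1 + Real.log t)) := by
    rw [natCast_mul_confWidth ht, Real.sq_sqrt (mul_nonneg htpos.le (by linarith))]
  have hgt : g * t ≤ 4 * (t * confWidth t δ) := by nlinarith
  have h1 : (t : ℝ) ≤ A * (16 * (8 * L + 3 * Real.log (1 + Real.log t))) := by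
    have h2 := pow_le_pow_left₀ (by positivity) hgt 2
    rw [mul_pow 4, hsq] at h2
    have h3 : g ^ 2 * t ≤ 16 * (2 * L + 6 * Real.log L + 3 * Real.log (1 + Real.log t)) := by
      refine le_of_mul_le_mul_right ?_ htpos
      nlinarith
    rw [hA, one_div_mul_eq_div, le_div_iff₀ (by positivity)]
    nlinarith
  set y : ℝ := t / A with hy
  have hy0 : 0 < y := by positivity
  have hty : (t : ℝ) = A * y := by rw [hy]; field_simp
  have hgoal : y ≤ 416 * (L + Real.log m) := by
    rcases le_or_gt y 1 with hy1 | hy1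
    · nlinarith
    have hly : 0 ≤ Real.log y := Real.log_nonneg hy1.le
    have h2 : Real.log (1 + Real.log t) ≤ 1 + Real.log m + Real.log y := by
      have h3 : 1 + Real.log t ≤ 2 * (m * (1 + Real.log y)) := by
        rw [hty, Real.log_mul hA0.ne' hy0.ne']
        have : Real.log A ≤ m := le_max_right _ _
        nlinarith
      have h4 := Real.log_le_log (by linarith) h3
      rw [Real.log_mul (by norm_num) (by positivity), Real.log_mul (by linarith) (by linarith)] at h4
      have h5 := Real.log_le_sub_one_of_pos (show 0 < 1 + Real.log y by linarith)
      have h6 := Real.log_two_lt_d9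
      linarith
    have h7 : y ≤ 16 * (8 * L + 3 * Real.log (1 + Real.log t)) := by
      rw [hty] at h1
      refine le_of_mul_le_mul_left ?_ hA0
      rw [hty]
      exact h1
    have h8 := log_le_div_add_four hy0
    linarith
  calc (t : ℝ) = A * y := hty
    _ ≤ A * (416 * (L + Real.log m)) := mul_le_mul_of_nonneg_left hgoal hA0.le
    _ = 416 / g ^ 2 * (L + Real.log m) := by rw [hA]; ring

end Inversion

/-! ### Covering the indices by cells -/

section Cells

variable {α ε : ℝ}

theorem lowCells_mul_le (hε : 0 < ε) (hα : α ≤ 1) : lowCells α ε * ε ≤ 1 - α := by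
  rw [← le_div_iff₀ hε]
  exact Nat.floor_le (div_nonneg (by linarith) hε.le)

theorem lt_lowCells_add_one_mul (hε : 0 < ε) : 1 - α < (lowCells α ε + 1) * ε := by
  rw [← div_lt_iff₀ hε]
  exact Nat.lt_floor_add_one _

theorem le_numCells_mul (hε : 0 < ε) : α + lowCells α ε * ε ≤ numCells α ε * ε := by
  have h := Nat.le_ceil (α / ε + lowCells α ε)
  calc α + lowCells α ε * ε = (α / ε + lowCells α ε) * ε := by field_simp
    _ ≤ numCells α ε * ε := mul_le_mul_of_nonneg_right h hε.le

theorem numCells_mul_le (hε : 0 < ε) (hα : α ∈ Set.Ioo (0 : ℝ) 1) : numCells α ε * ε ≤ 1 + ε := by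
  have hα0 := hα.1
  have h := Nat.ceil_lt_add_one (show 0 ≤ α / ε + lowCells α ε by positivity)
  calc numCells α ε * ε ≤ (α / ε + lowCells α ε + 1) * ε := mul_le_mul_of_nonneg_right h.le hε.le
    _ = α + lowCells α ε * ε + ε := by field_simp
    _ ≤ 1 + ε := by linarith [lowCells_mul_le hε hα.2.le]

/-- The `i`-th cell of indices, where the first one is extended to the left up to `0`. -/
noncomputable def cell (α ε : ℝ) (i : ℕ) : Set ℝ :=
  Set.Icc (if i = 1 then 0 else cellStart α ε i) (cellStart α ε (i + 1))

/-- Cells have length ε; since b₁ < ε, extending the first one to 0 adds less than another ε. -/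
theorem measureReal_cell_le (hε : 0 < ε) (i : ℕ) :
    (volume.restrict (Set.Icc (0 : ℝ) 1)).real (cell α ε i) ≤ 2 * ε := by
  refine ENNReal.toReal_le_of_le_ofReal (by positivity) ?_
  refine (Measure.restrict_apply_le _ _).trans ?_
  rw [cell, Real.volume_Icc]
  refine ENNReal.ofReal_le_ofReal ?_
  unfold cellStart
  split_ifs with h
  · subst h
    push_cast
    linarith [lt_lowCells_add_one_mul (α := α) hε]
  · push_cast
    linarith

/-- The choice of m makes b_{m+1} ≥ 1. The natural floor sends negative values to 0, so indices
below b₁ land in the extended first cell. -/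
theorem exists_mem_cell (hε : 0 < ε) (hα : 0 < α) {j : ℝ} (hj : j ∈ Set.Ioo (0 : ℝ) 1) :
    ∃ i ∈ Finset.Icc 1 (numCells α ε), j ∈ cell α ε i := by
  set z : ℝ := (j - ((1 - α) - lowCells α ε * ε)) / ε with hz
  have hzε : z * ε = j - ((1 - α) - lowCells α ε * ε) := by
    rw [hz]
    field_simp
  have hm := le_numCells_mul (α := α) hε
  have hzm : z < numCells α ε := by
    refine lt_of_mul_lt_mul_right ?_ hε.le
    rw [hzε]
    linarith [hj.2]
  have hm0 : numCells α ε ≠ 0 := by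
    intro h0
    rw [h0, Nat.cast_zero, zero_mul] at hm
    have : 0 ≤ lowCells α ε * ε := by positivity
    linarith
  have hfl : ⌊z⌋₊ < numCells α ε := (Nat.floor_lt' hm0).mpr hzm
  have hfl2 : z * ε < (⌊z⌋₊ + 1) * ε := mul_lt_mul_of_pos_right (Nat.lt_floor_add_one z) hε
  refine ⟨⌊z⌋₊ + 1, Finset.mem_Icc.mpr ⟨by omega, by omega⟩, ?_, ?_⟩
  · split_ifs with h
    · exact hj.1.le
    · have h0 : ⌊z⌋₊ ≠ 0 := by omega
      have hz0 : 0 ≤ z := by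
        by_contra hcon
        exact h0 (Nat.floor_of_nonpos (not_le.mp hcon).le)
      have h1 : ⌊z⌋₊ * ε ≤ z * ε := mul_le_mul_of_nonneg_right (Nat.floor_le hz0) hε.le
      unfold cellStart
      push_cast
      linarith
  · unfold cellStart
    push_cast
    linarith

end Cells

/-! ### Gaps against confidence widths -/

section Gap

variable {ι : Type*} {ν : ι → Measure ℝ} {α ε Δ : ℝ} {Gs : ι}

theorem gap_pos (hΔ : 0 < Δ) (G : ι) (i : ℕ) : 0 < gap ν α ε Δ Gs G i :=
  hΔ.trans_le ((le_max_left _ _).trans (le_max_left _ _))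

theorem le_gap (G : ι) (i : ℕ) : Δ ≤ gap ν α ε Δ Gs G i :=
  (le_max_left _ _).trans (le_max_left _ _)

variable [∀ G, IsProbabilityMeasure (ν G)]

theorem gap_le_one [Finite ι] (hν : ∀ G, ∀ᵐ m ∂(ν G), m ∈ Set.Icc (0 : ℝ) 1) (hΔ : Δ ≤ 1) (G : ι)
    (i : ℕ) : gap ν α ε Δ Gs G i ≤ 1 := by
  have hq : ∀ G p, quantile (ν G) p ∈ Set.Icc (0 : ℝ) 1 := fun G => quantile_mem_Icc (hν G)
  have : Nonempty ι := ⟨G⟩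
  have hsup : ⨆ G' : ι, quantile (ν G') (1 - α - ε) ≤ 1 := ciSup_le fun G' => (hq G' _).2
  refine max_le (max_le hΔ ?_) (max_le ?_ ?_)
  · unfold groupGap
    linarith [(hq G (1 - α + ε)).1]
  · unfold topGap
    split_ifs with h
    · have : 0 ≤ ⨆ G' : {G' : ι // G' ≠ Gs}, quantile (ν G') (1 - α + ε) :=
        Real.iSup_nonneg fun G' => (hq G' _).1
      linarith
    · exact zero_le_one
  · unfold cellGap
    split_ifs
    · linarith [(hq G (1 - α - ε)).2, (hq G (cellStart α ε (i + 1))).1]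
    · linarith [(hq G (1 - α + ε)).1, (hq G (cellStart α ε i)).2]
    · exact zero_le_one

variable [Fintype ι] {N : ℕ} {δ : ℝ} {μ : ι → Fin N → ℝ}

omit [∀ G, IsProbabilityMeasure (ν G)] in
/-- An arm can only be unresolved while the confidence width is comparable to its gap. -/
theorem gap_le_of_unresolved (hε : 0 < ε)
    (hεα : ε < min α (1 - α))
    (hlow : ∀ G, quantile (ν G) (1 - α - ε) ≤ armQuantile α μ G)
    (hhigh : ∀ G, armQuantile α μ G ≤ quantile (ν G) (1 - α + ε))
    {G : ι} {k : Fin N} {s i : ℕ} {j : ℝ} (hj : j ∈ Set.Ioo (0 : ℝ) 1) (hji : j ∈ cell α ε i)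
    (hμ : μ G k = quantile (ν G) j) (h : Unresolved α Δ δ μ Gs G k s) :
    gap ν α ε Δ Gs G i ≤ 4 * armWidth ι N δ s := by
  obtain ⟨h1, ⟨G₁, hne, h2⟩, h3, h4⟩ := h
  have hεα1 : ε < α := hεα.trans_le (min_le_left _ _)
  have hW : 0 ≤ armWidth ι N δ s := Real.sqrt_nonneg _
  have : Nonempty ι := ⟨G⟩
  refine max_le (max_le h1.le ?_) (max_le ?_ ?_)
  · have hsup : ⨆ G' : ι, quantile (ν G') (1 - α - ε) ≤ armQuantile α μ G + 4 * armWidth ι N δ s :=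
      ciSup_le fun G' => (hlow G').trans (h3 G')
    unfold groupGap
    linarith [hhigh G]
  -- The near-optimal group `G₁` other than `Gs` bounds the supremum in Δ̃₀ from below.
  · have hsup : ⨆ G' : ι, quantile (ν G') (1 - α - ε) ≤ armQuantile α μ G₁ + 4 * armWidth ι N δ s :=
      ciSup_le fun G' => (hlow G').trans (h2 G')
    have hle := le_ciSup (Set.finite_range
      fun G' : {G' : ι // G' ≠ Gs} => quantile (ν G') (1 - α + ε)).bddAbove ⟨G₁, hne⟩
    rw [topGap, if_pos ⟨G₁, hne⟩]
    linarith [hhigh G₁]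
  · rw [abs_le] at h4
    unfold cellGap
    split_ifs with hi hi'
    -- Here b_{i+1} ≤ 1-α-2ε, so the arm's mean is at most F⁻¹(b_{i+1}) while q_G is at least
    -- F⁻¹(1-α-ε); the cell gap is at most their distance. The next case is the mirror image.
    · have hi2 : (i : ℝ) ≤ lowCells α ε - 2 := by
        have : (i : ℤ) ≤ (lowCells α ε : ℤ) - 2 := by omega
        exact_mod_cast this
      have hb : cellStart α ε (i + 1) < 1 := by
        unfold cellStart
        push_cast
        nlinarith
      have := quantile_mono (ν := ν G) hj.1 hji.2 hb
      linarith [hlow G]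
    · have hi2 : (lowCells α ε : ℝ) + 2 ≤ i := by
        have : (lowCells α ε : ℤ) + 2 ≤ i := by omega
        exact_mod_cast this
      have hb : 0 < cellStart α ε i := by
        have := (lt_min_iff.mp hεα).2
        unfold cellStart
        nlinarith
      -- The extension to 0 concerns only the first cell, so here j ≥ b_i.
      have hi1 : i ≠ 1 := by omega
      have hji1 := hji.1
      rw [if_neg hi1] at hji1
      have := quantile_mono (ν := ν G) hb hji1 hj.2
      linarith [hhigh G]
    · positivity

end Gap

/-! ### The worst-case bound -/

section WorstCase

theorem le_numArms_mul {g : ℕ} {ε δ : ℝ} (hε : 0 < ε) :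
    Real.log (2 * g / δ) ≤ numArms g ε δ * (2 * ε ^ 2) := by
  have h := Nat.le_ceil (1 / (2 * ε ^ 2) * Real.log (2 * g / δ))
  calc Real.log (2 * g / δ) = 1 / (2 * ε ^ 2) * Real.log (2 * g / δ) * (2 * ε ^ 2) := by field_simp
    _ ≤ _ := mul_le_mul_of_nonneg_right h (by positivity)

theorem two_lt_natCast_div {g : ℕ} {δ : ℝ} (hg : 1 ≤ g) (hδ : 0 < δ) (hδ2 : δ < 1 / 2) :
    (2 : ℝ) < g / δ := by
  have hg1 : (1 : ℝ) ≤ g := by exact_mod_cast hg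
  rw [lt_div_iff₀ hδ]
  linarith

theorem numArms_pos {g : ℕ} {ε δ : ℝ} (hg : 1 ≤ g) (hε : 0 < ε) (hδ : 0 < δ) (hδ2 : δ < 1 / 2) :
    0 < numArms g ε δ := by
  have h2 := two_lt_natCast_div hg hδ hδ2
  refine Nat.ceil_pos.mpr (mul_pos (by positivity) (Real.log_pos ?_))
  rw [mul_div_assoc]
  linarith

theorem numArms_le {g : ℕ} {ε δ : ℝ} (hg : 1 ≤ g) (hδ : 0 < δ) (hδε : δ < ε) (hε2 : ε < 1 / 2) :
    (numArms g ε δ : ℝ) ≤ 2 * Real.log (g / δ) / ε ^ 2 := by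
  have hε : 0 < ε := hδ.trans hδε
  have h2 := two_lt_natCast_div hg hδ (hδε.trans hε2)
  have hlog2 : Real.log 2 ≤ Real.log (g / δ) := Real.log_le_log (by norm_num) h2.le
  have hl2 := Real.log_two_gt_d9
  have hsplit : Real.log (2 * g / δ) = Real.log 2 + Real.log (g / δ) := by
    rw [mul_div_assoc, Real.log_mul (by norm_num) (by linarith)]
  have hceil : (numArms g ε δ : ℝ) < 1 / (2 * ε ^ 2) * Real.log (2 * g / δ) + 1 :=
    Nat.ceil_lt_add_one (mul_nonneg (by positivity) (by rw [hsplit]; linarith))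
  have h3 : 1 / (2 * ε ^ 2) * Real.log (2 * g / δ) ≤ Real.log (g / δ) / ε ^ 2 := by
    rw [one_div_mul_eq_div, div_le_div_iff₀ (by positivity) (by positivity), hsplit]
    nlinarith [sq_nonneg ε]
  have h4 : 1 ≤ Real.log (g / δ) / ε ^ 2 := by
    rw [one_le_div (by positivity)]
    nlinarith
  calc (numArms g ε δ : ℝ) ≤ Real.log (g / δ) / ε ^ 2 + Real.log (g / δ) / ε ^ 2 := by linarith
    _ = _ := by ring

/-- Since δ < ε, 1/ε is at most g/δ, so N is polynomial in g/δ and contributes no separate logarithm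
of 1/ε. -/
theorem log_numArms_le {g : ℕ} {ε δ : ℝ} (hg : 1 ≤ g) (hδ : 0 < δ) (hδε : δ < ε)
    (hε2 : ε < 1 / 2) : Real.log (numArms g ε δ) ≤ 4 * Real.log (g / δ) := by
  have hε : 0 < ε := hδ.trans hδε
  have hδ2 := hδε.trans hε2
  have h2 := two_lt_natCast_div hg hδ hδ2
  have hN : (0 : ℝ) < numArms g ε δ := by exact_mod_cast numArms_pos hg hε hδ hδ2
  have hg1 : (1 : ℝ) ≤ g := by exact_mod_cast hg
  have h3 : (numArms g ε δ : ℝ) ≤ (g / δ) ^ 4 := by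
    refine (numArms_le hg hδ hδε hε2).trans ?_
    rw [div_le_iff₀ (by positivity)]
    have h4 : Real.log (g / δ) ≤ g / δ :=
      (Real.log_le_sub_one_of_pos (by linarith)).trans (by linarith)
    have h5 : 1 ≤ g / δ * ε := by
      rw [div_mul_eq_mul_div, one_le_div hδ]
      nlinarith
    have h6 : 1 ≤ (g / δ * ε) ^ 2 := one_le_pow₀ h5
    calc 2 * Real.log (g / δ) ≤ (g / δ) * (g / δ) := by nlinarith
      _ ≤ (g / δ) * (g / δ) * (g / δ * ε) ^ 2 := le_mul_of_one_le_right (by positivity) h6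
      _ = _ := by ring
  have h4 := Real.log_le_log hN h3
  rw [Real.log_pow] at h4
  exact_mod_cast h4

variable {ι : Type*} [Fintype ι] [Nonempty ι] {ν : ι → Measure ℝ} {α ε Δ δ c : ℝ} {Gs : ι}

/-- With Λ = log(g/δ), the logarithm splits into Λ for g/δ, 4Λ for N, and Λ + l for the iterated
logarithm, where the factor 2 from squaring the gap costs log 2 ≤ Λ. Together with mε ≤ 2 and N ≤
2Λ/ε², the constant is 3 · 2 · 2 · 6 = 72. -/
theorem instanceBound_le_worstCaseBound (hc : 0 < c) (hα : α ∈ Set.Ioo (0 : ℝ) 1) (hδ : 0 < δ)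
    (hδε : δ < ε) (hεα : ε < min α (1 - α)) (hΔ : Δ ∈ Set.Ioo (0 : ℝ) 1) :
    instanceBound c ν α ε Δ δ Gs ≤ worstCaseBound (72 * c) (Fintype.card ι) ε Δ δ := by
  have hε : 0 < ε := hδ.trans hδε
  have hε2 : ε < 1 / 2 := by
    have := lt_min_iff.mp hεα
    linarith [this.1, this.2]
  have hδ2 := hδε.trans hε2
  set g := Fintype.card ι with hg
  have hg1 : 1 ≤ g := Fintype.card_pos
  have h2 := two_lt_natCast_div hg1 hδ hδ2
  have hN0 := numArms_pos hg1 hε hδ hδ2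
  have hNle := numArms_le hg1 hδ hδε hε2
  have hlogN := log_numArms_le hg1 hδ hδε hε2
  set N := numArms g ε δ
  have hN1 : (1 : ℝ) ≤ N := by exact_mod_cast hN0
  set Λ := Real.log (g / δ) with hΛ
  have hl2 := Real.log_two_gt_d9
  have hlog2 : Real.log 2 ≤ Λ := Real.log_le_log (by norm_num) h2.le
  set l := Real.log (max 1 (Real.log (1 / Δ))) with hl
  have hl0 : 0 ≤ l := Real.log_nonneg (le_max_left _ _)
  have hΛ0 : 0 < Λ := by linarith
  have hΔ0 := hΔ.1
  have hterm : ∀ G : ι, ∀ i ∈ Finset.Icc 1 (numCells α ε),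
      c / gap ν α ε Δ Gs G i ^ 2 * Real.log (g * N / δ * max 1 (Real.log (1 / gap ν α ε Δ Gs G i ^ 2)))
        * (3 * ε * N) ≤ c / Δ ^ 2 * (6 * Λ + l) * (3 * ε * N) := by
    intro G i _
    have hle : Δ ≤ gap ν α ε Δ Gs G i := le_gap G i
    set y := gap ν α ε Δ Gs G i
    have hy0 : 0 < y := hΔ0.trans_le hle
    have hsq : Δ ^ 2 ≤ y ^ 2 := pow_le_pow_left₀ hΔ0.le hle 2
    have hm1 : 1 ≤ max 1 (Real.log (1 / y ^ 2)) := le_max_left _ _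
    have hmle : max 1 (Real.log (1 / y ^ 2)) ≤ 2 * max 1 (Real.log (1 / Δ)) := by
      have hd : Real.log (1 / y ^ 2) ≤ 2 * Real.log (1 / Δ) := by
        have h3 := Real.log_le_log (by positivity) (one_div_le_one_div_of_le (by positivity) hsq)
        refine h3.trans (le_of_eq ?_)
        rw [one_div, one_div, Real.log_inv, Real.log_inv, Real.log_pow]
        push_cast
        ring
      have h4 : (1 : ℝ) ≤ max 1 (Real.log (1 / Δ)) := le_max_left _ _
      have h5 : Real.log (1 / Δ) ≤ max 1 (Real.log (1 / Δ)) := le_max_right _ _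
      exact max_le (by linarith) (by linarith)
    have hlogm : Real.log (max 1 (Real.log (1 / y ^ 2))) ≤ Λ + l := by
      have h3 := Real.log_le_log (by linarith) hmle
      rw [Real.log_mul (by norm_num) (by positivity)] at h3
      linarith
    have hlog : Real.log (g * N / δ * max 1 (Real.log (1 / y ^ 2))) ≤ 6 * Λ + l := by
      rw [mul_div_right_comm, Real.log_mul (by positivity) (by linarith),
        Real.log_mul (by linarith) (by linarith)]
      linarith
    refine mul_le_mul_of_nonneg_right ?_ (by positivity)
    refine mul_le_mul ?_ hlog (Real.log_nonneg ?_) (by positivity)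
    · exact div_le_div_of_nonneg_left hc.le (by positivity) hsq
    · have h3 : (1 : ℝ) ≤ g * N / δ := by
        rw [mul_div_right_comm]
        nlinarith
      nlinarith
  have hmε : numCells α ε * ε ≤ 2 := (numCells_mul_le hε hα).trans (by linarith)
  have hg0 : (0 : ℝ) < g := by exact_mod_cast hg1
  calc instanceBound c ν α ε Δ δ Gs
      ≤ ∑ _G : ι, ∑ i ∈ Finset.Icc 1 (numCells α ε), c / Δ ^ 2 * (6 * Λ + l) * (3 * ε * N) :=
        Finset.sum_le_sum fun G _ => Finset.sum_le_sum fun i hi => hterm G i hi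
    _ = g * (c / Δ ^ 2 * (6 * Λ + l) * (3 * N)) * (numCells α ε * ε) := by
        simp only [Finset.sum_const, Finset.card_univ, nsmul_eq_mul, Nat.card_Icc,
          Nat.add_sub_cancel]
        ring
    _ ≤ g * (c / Δ ^ 2 * (6 * Λ + l) * (3 * N)) * 2 :=
        mul_le_mul_of_nonneg_left hmε (by positivity)
    _ ≤ g * (c / Δ ^ 2 * (6 * Λ + l) * (3 * (2 * Λ / ε ^ 2))) * 2 := by
        gcongr
    _ = 12 * c * (g / (ε ^ 2 * Δ ^ 2)) * (6 * Λ ^ 2 + Λ * l) := by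
        field_simp
        ring
    _ ≤ 12 * c * (g / (ε ^ 2 * Δ ^ 2)) * (6 * (Λ ^ 2 + Λ * l)) := by
        refine mul_le_mul_of_nonneg_left ?_ (by positivity)
        nlinarith [mul_nonneg (by linarith : 0 ≤ Λ) hl0]
    _ = worstCaseBound (72 * c) g ε Δ δ := by
        unfold worstCaseBound
        ring

end WorstCase

/-! ### Success on the good event -/

section Success

variable {ι : Type*} [Fintype ι] {N : ℕ} {ν : ι → Measure ℝ} {α ε Δ δ : ℝ} {Gs : ι}

open Classical in
/-- The outcomes in which all confidence intervals are valid and the empirical distribution of the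
arm indices is close to the uniform distribution. -/
structure GoodOutcome (ν : ι → Measure ℝ) (α ε δ : ℝ) (ω : Outcome ι N) : Prop where
  index_mem : ∀ G k, (ω (G, k)).1 ∈ Set.Ioo (0 : ℝ) 1
  confidence : ∀ G k, ConfidenceValid (δ / (N * Fintype.card ι : ℕ))
    (quantile (ν G) (ω (G, k)).1) (ω (G, k)).2
  upper : ∀ G, ((Finset.univ.filter fun k => (ω (G, k)).1 ∈ Set.Ioi (1 - α + ε)).card : ℝ)
    < (α - ε + ε) * N
  lower : ∀ G, ((Finset.univ.filter fun k => (ω (G, k)).1 ∈ Set.Iio (1 - α - ε)).card : ℝ)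
    < (1 - α - ε + ε) * N
  cells : ∀ G, ∀ i ∈ Finset.Icc 1 (numCells α ε),
    ((Finset.univ.filter fun k => (ω (G, k)).1 ∈ cell α ε i).card : ℝ) < (2 * ε + 2 * ε) * N

/-- The means of the arms. -/
noncomputable def armMean (ν : ι → Measure ℝ) (ω : Outcome ι N) (G : ι) (k : Fin N) : ℝ :=
  quantile (ν G) (ω (G, k)).1

namespace GoodOutcome

variable {ω : Outcome ι N}

/-- Fewer than αN indices exceed 1-α+ε, so at least (1-α)N arms have mean at most F_G⁻¹(1-α+ε). -/
theorem armQuantile_le (h : GoodOutcome ν α ε δ ω) (hN : 0 < N) (hε : 0 < ε)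
    (hεα : ε < min α (1 - α)) (G : ι) :
    armQuantile α (armMean ν ω) G ≤ quantile (ν G) (1 - α + ε) := by
  classical
  obtain ⟨h1, h2⟩ := lt_min_iff.mp hεα
  rw [armQuantile, empQuantile_le_iff hN ⟨by linarith, by linarith⟩]
  have hcard := Finset.card_filter_add_card_filter_not (s := (Finset.univ : Finset (Fin N)))
    (fun k => (ω (G, k)).1 ∈ Set.Ioi (1 - α + ε))
  rw [Finset.card_univ, Fintype.card_fin] at hcard
  have hcard' : ((Finset.univ.filter fun k => (ω (G, k)).1 ∈ Set.Ioi (1 - α + ε)).card : ℝ)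
      + (Finset.univ.filter fun k => ¬ (ω (G, k)).1 ∈ Set.Ioi (1 - α + ε)).card = N := by
    exact_mod_cast hcard
  have hle : ((Finset.univ.filter fun k => ¬ (ω (G, k)).1 ∈ Set.Ioi (1 - α + ε)).card : ℝ)
      ≤ (Finset.univ.filter fun k => armMean ν ω G k ≤ quantile (ν G) (1 - α + ε)).card := by
    refine Nat.cast_le.mpr (Finset.card_le_card fun k hk => ?_)
    rw [Finset.mem_filter] at hk ⊢
    exact ⟨hk.1, quantile_mono (h.index_mem G k).1 (not_lt.mp hk.2) (by linarith)⟩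
  have := h.upper G
  linarith

theorem le_armQuantile (h : GoodOutcome ν α ε δ ω) (hN : 0 < N) (hε : 0 < ε)
    (hεα : ε < min α (1 - α)) (G : ι) :
    quantile (ν G) (1 - α - ε) ≤ armQuantile α (armMean ν ω) G := by
  classical
  obtain ⟨h1, h2⟩ := lt_min_iff.mp hεα
  by_contra hcon
  have hq := (empQuantile_le_iff hN (p := 1 - α) ⟨by linarith, by linarith⟩ (armMean ν ω G) _).mp
    (le_refl (armQuantile α (armMean ν ω) G))
  have hle : ((Finset.univ.filter fun k =>
        armMean ν ω G k ≤ armQuantile α (armMean ν ω) G).card : ℝ)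
      ≤ (Finset.univ.filter fun k => (ω (G, k)).1 ∈ Set.Iio (1 - α - ε)).card := by
    refine Nat.cast_le.mpr (Finset.card_le_card fun k hk => ?_)
    rw [Finset.mem_filter] at hk ⊢
    refine ⟨hk.1, ?_⟩
    by_contra hj
    have := quantile_mono (ν := ν G) (by linarith) (not_lt.mp hj) (h.index_mem G k).2
    exact hcon (this.trans hk.2)
  have := h.lower G
  linarith

end GoodOutcome

theorem log_natCast_mul_div_mul {g δ y : ℝ} (hg : 0 < g) (hN : 0 < N) (hδ : 0 < δ) (hy : 1 ≤ y) :
    Real.log (g * N / δ * y) = Real.log (1 / (δ / (N * g))) + Real.log y := by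
  have hN0 : (0 : ℝ) < N := by exact_mod_cast hN
  rw [Real.log_mul (by positivity) (by linarith), one_div_div, mul_comm (N : ℝ) g]

/-- The inversion bounds s, whereas the arm has s+1 pulls. Because the gap is at most 1 and the
logarithm at least 3, the extra pull is paid for by raising 416 to 417; this also covers arms pulled
at most once. -/
theorem pulls_le_of_invariant [Nonempty ι] [∀ G, IsProbabilityMeasure (ν G)]
    (hν : ∀ G, ∀ᵐ m ∂(ν G), m ∈ Set.Icc (0 : ℝ) 1) (hN : 0 < N) (hδ : 0 < δ)
    (hL : 3 ≤ Real.log (1 / (δ / (N * Fintype.card ι : ℕ)))) (hε : 0 < ε)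
    (hεα : ε < min α (1 - α)) (hΔ : Δ ∈ Set.Ioo (0 : ℝ) 1) {ω : Outcome ι N}
    (hω : GoodOutcome ν α ε δ ω) {t : ℕ} {st : Memory ι N}
    (h : Invariant α Δ δ (fun s G k => (ω (G, k)).2 s) (armMean ν ω) Gs t st) (G : ι) (k : Fin N)
    {i : ℕ} (hi : (ω (G, k)).1 ∈ cell α ε i) :
    (st.pulls G k : ℝ) ≤ 417 / gap ν α ε Δ Gs G i ^ 2
      * Real.log (Fintype.card ι * N / δ * max 1 (Real.log (1 / gap ν α ε Δ Gs G i ^ 2))) := by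
  have hg : (0 : ℝ) < Fintype.card ι := by exact_mod_cast Fintype.card_pos
  set y := gap ν α ε Δ Gs G i with hy
  have hy0 : 0 < y := gap_pos hΔ.1 G i
  have hy1 : y ≤ 1 := gap_le_one hν hΔ.2.le G i
  have hm1 : 1 ≤ max 1 (Real.log (1 / y ^ 2)) := le_max_left _ _
  rw [log_natCast_mul_div_mul hg hN hδ hm1]
  rw [Nat.cast_mul] at hL
  set M := Real.log (1 / (δ / (N * Fintype.card ι))) + Real.log (max 1 (Real.log (1 / y ^ 2)))
    with hM
  have hM3 : 3 ≤ M := by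
    have := Real.log_nonneg hm1
    linarith
  have hA : 1 ≤ 1 / y ^ 2 := by
    rw [one_le_div (by positivity)]
    exact pow_le_one₀ hy0.le hy1
  have hAM : 1 ≤ 1 / y ^ 2 * M := by nlinarith
  have hsplit : 417 / y ^ 2 * M = 416 / y ^ 2 * M + 1 / y ^ 2 * M := by ring
  rw [hsplit]
  have h416 : 0 ≤ 416 / y ^ 2 * M := by positivity
  rcases Nat.lt_or_ge (st.pulls G k) 2 with hp | hp
  · have : (st.pulls G k : ℝ) ≤ 1 := by exact_mod_cast Nat.lt_succ_iff.mp hp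
    linarith
  · obtain ⟨s, hs⟩ : ∃ s, st.pulls G k = s + 1 := ⟨st.pulls G k - 1, by omega⟩
    have hs1 : 1 ≤ s := by omega
    have hU := h.history G k s hs1 hs
    have hgap := gap_le_of_unresolved hε hεα (hω.le_armQuantile hN hε hεα)
      (hω.armQuantile_le hN hε hεα) (hω.index_mem G k) hi rfl hU
    rw [armWidth, Nat.cast_mul] at hgap
    have := le_of_le_four_mul_confWidth hL hs1 hy0 hgap
    rw [← hM] at this
    rw [hs, Nat.cast_add, Nat.cast_one]
    linarith

/-- A cell holds at most 4εN arms while the bound is written with 3εN, whence 556 = 417 · 4/3. -/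
theorem totalPulls_le_of_invariant [Nonempty ι] [∀ G, IsProbabilityMeasure (ν G)]
    (hν : ∀ G, ∀ᵐ m ∂(ν G), m ∈ Set.Icc (0 : ℝ) 1) (hN : 0 < N) (hδ : 0 < δ)
    (hL : 3 ≤ Real.log (1 / (δ / (N * Fintype.card ι : ℕ)))) (hε : 0 < ε)
    (hεα : ε < min α (1 - α)) (hΔ : Δ ∈ Set.Ioo (0 : ℝ) 1) {ω : Outcome ι N}
    (hω : GoodOutcome ν α ε δ ω) {t : ℕ} {st : Memory ι N}
    (h : Invariant α Δ δ (fun s G k => (ω (G, k)).2 s) (armMean ν ω) Gs t st) :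
    (st.totalPulls : ℝ) ≤ ∑ G : ι, ∑ i ∈ Finset.Icc 1 (numCells α ε),
      556 / gap ν α ε Δ Gs G i ^ 2
        * Real.log (Fintype.card ι * N / δ * max 1 (Real.log (1 / gap ν α ε Δ Gs G i ^ 2)))
        * (3 * ε * N) := by
  classical
  have hα : 0 < α := hε.trans (lt_min_iff.mp hεα).1
  unfold Memory.totalPulls
  push_cast
  refine Finset.sum_le_sum fun G _ => ?_
  -- Neighbouring cells share end points; choosing one cell per arm counts each arm once.
  choose c hc hcell using fun k => exists_mem_cell (α := α) hε hα (hω.index_mem G k)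
  rw [← Finset.sum_fiberwise_of_maps_to (s := Finset.univ) (t := Finset.Icc 1 (numCells α ε))
    (g := c) fun k _ => hc k]
  refine Finset.sum_le_sum fun i hi => ?_
  set B := 417 / gap ν α ε Δ Gs G i ^ 2
    * Real.log (Fintype.card ι * N / δ * max 1 (Real.log (1 / gap ν α ε Δ Gs G i ^ 2))) with hB
  have hpulls : ∀ k ∈ Finset.univ.filter fun k => (ω (G, k)).1 ∈ cell α ε i,
      (st.pulls G k : ℝ) ≤ B := fun k hk =>
    pulls_le_of_invariant hν hN hδ hL hε hεα hΔ hω h G k (Finset.mem_filter.mp hk).2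
  have hsub : (Finset.univ.filter fun k => c k = i)
      ⊆ Finset.univ.filter fun k => (ω (G, k)).1 ∈ cell α ε i := by
    intro k hk
    rw [Finset.mem_filter] at hk ⊢
    exact ⟨hk.1, hk.2 ▸ hcell k⟩
  have hB0 : 0 ≤ B := by
    have hg : (0 : ℝ) < Fintype.card ι := by exact_mod_cast Fintype.card_pos
    have hm1 : 1 ≤ max 1 (Real.log (1 / gap ν α ε Δ Gs G i ^ 2)) := le_max_left _ _
    refine mul_nonneg (by positivity) ?_
    rw [Nat.cast_mul] at hL
    rw [log_natCast_mul_div_mul hg hN hδ hm1]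
    have := Real.log_nonneg hm1
    linarith
  calc ∑ k ∈ Finset.univ.filter fun k => c k = i, (st.pulls G k : ℝ)
      ≤ ∑ k ∈ Finset.univ.filter fun k => c k = i, B :=
        Finset.sum_le_sum fun k hk => hpulls k (hsub hk)
    _ = (Finset.univ.filter fun k => c k = i).card * B := by rw [Finset.sum_const, nsmul_eq_mul]
    _ ≤ (Finset.univ.filter fun k => (ω (G, k)).1 ∈ cell α ε i).card * B :=
        mul_le_mul_of_nonneg_right (Nat.cast_le.mpr (Finset.card_le_card hsub)) hB0
    _ ≤ (2 * ε + 2 * ε) * N * B := by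
        refine mul_le_mul_of_nonneg_right ?_ hB0
        have := (hω.cells G i hi).le
        convert this
    _ = _ := by
        rw [hB]
        ring

theorem exists_not_running_of_goodOutcome [Nonempty ι] (hN : 0 < N) (hα : α ∈ Set.Ioo (0 : ℝ) 1)
    (hL : 3 ≤ Real.log (1 / (δ / (N * Fintype.card ι : ℕ)))) (hΔ : 0 < Δ) {ω : Outcome ι N}
    (hω : GoodOutcome ν α ε δ ω) :
    ∃ t, ¬ (Memory.run α Δ δ (fun s G k => (ω (G, k)).2 s) t).Running Δ := by
  by_contra hcon
  push Not at hcon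
  have Gs : ι := Classical.arbitrary ι
  obtain ⟨t, ht⟩ := exists_nat_gt (416 / Δ ^ 2 * (Real.log (1 / (δ / (N * Fintype.card ι : ℕ)))
    + Real.log (max 1 (Real.log (1 / Δ ^ 2)))))
  have hinv := invariant_run (μ := armMean ν ω) Gs hN hα hω.confidence (t + 1) fun s _ => hcon s
  have hlt := hinv.lt_four_mul_armWidth hN hα hω.confidence (by omega) (hcon (t + 1))
  have := le_of_le_four_mul_confWidth hL (by omega : 1 ≤ t + 1) hΔ hlt.le
  rw [Nat.cast_add, Nat.cast_one] at this
  linarith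

theorem succeeds_of_goodOutcome [Nonempty ι] [∀ G, IsProbabilityMeasure (ν G)]
    (hν : ∀ G, ∀ᵐ m ∂(ν G), m ∈ Set.Icc (0 : ℝ) 1) (hN : 0 < N) (hδ : 0 < δ)
    (hL : 3 ≤ Real.log (1 / (δ / (N * Fintype.card ι : ℕ)))) (hε : 0 < ε)
    (hεα : ε < min α (1 - α)) (hα : α ∈ Set.Ioo (0 : ℝ) 1) (hΔ : Δ ∈ Set.Ioo (0 : ℝ) 1)
    (hcard : 1 < Fintype.card ι) {ω : Outcome ι N} (hω : GoodOutcome ν α ε δ ω) :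
    Succeeds ν α ε Δ δ (∑ G : ι, ∑ i ∈ Finset.Icc 1 (numCells α ε),
      556 / gap ν α ε Δ Gs G i ^ 2
        * Real.log (Fintype.card ι * N / δ * max 1 (Real.log (1 / gap ν α ε Δ Gs G i ^ 2)))
        * (3 * ε * N)) ω := by
  classical
  have hex := exists_not_running_of_goodOutcome hN hα hL hΔ.1 hω
  have hspec := Nat.find_spec hex
  have hmin := fun s (hs : s < Nat.find hex) => not_not.mp (Nat.find_min hex hs)
  set t := Nat.find hex
  -- With two groups and infinite initial width the first round always takes place, so at exit all
  -- confidence bounds exist.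
  have ht : 1 ≤ t := by
    by_contra h0
    obtain h0 : t = 0 := by omega
    rw [h0] at hspec
    exact hspec ⟨by simpa [Memory.run, Memory.init] using hcard, EReal.coe_lt_top Δ⟩
  have hinv := invariant_run (μ := armMean ν ω) Gs hN hα hω.confidence t hmin
  refine ⟨t, _, rfl, hspec, hinv.exists_mayReturn, fun G hG G' => ?_,
    totalPulls_le_of_invariant hν hN hδ hL hε hεα hΔ hω hinv⟩
  have h1 : armQuantile α (armMean ν ω) G' - Δ ≤ armQuantile α (armMean ν ω) G :=
    hinv.le_of_mayReturn hN hα hω.confidence ht hΔ.1.le hspec hG G'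
  linarith [hω.le_armQuantile hN hε hεα G', hω.armQuantile_le hN hε hεα G]

/-- With a single group, the algorithm stops at once. -/
theorem succeeds_of_card_le_one [Nonempty ι] (hε : 0 < ε) (hεα : ε < min α (1 - α))
    (hΔ : 0 ≤ Δ) (hcard : Fintype.card ι ≤ 1) {B : ℝ} (hB : 0 ≤ B) (ω : Outcome ι N) :
    Succeeds ν α ε Δ δ B ω := by
  have hsub : Subsingleton ι := Fintype.card_le_one_iff_subsingleton.mp hcard
  have h2 := lt_min_iff.mp hεα
  refine ⟨0, _, rfl, fun h => ?_, ?_, fun G _ G' => ?_, ?_⟩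
  · have h1 : 1 < Fintype.card ι := by simpa [Memory.run, Memory.init] using h.1
    omega
  · refine ⟨Classical.arbitrary ι, Finset.mem_univ _, fun G' _ => ?_⟩
    rw [Subsingleton.elim G' (Classical.arbitrary ι)]
  · rw [Subsingleton.elim G' G]
    have := quantile_mono (ν := ν G) (p := 1 - α - ε) (q := 1 - α + ε) (by linarith)
      (by linarith) (by linarith)
    linarith
  · simpa [Memory.totalPulls, Memory.run, Memory.init] using hB

end Success

/-! ### Probability of the good event -/

section Probability

variable {ι : Type*} [Fintype ι] [Nonempty ι] (ν : ι → Measure ℝ)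
  [∀ G, IsProbabilityMeasure (ν G)] (κ : Kernel ℝ ℝ) [IsMarkovKernel κ] {α ε Δ δ : ℝ}

theorem exp_neg_numArms_le {g : ℕ} (hg : 1 ≤ g) (hε : 0 < ε) (hδ : 0 < δ) :
    Real.exp (-(2 * numArms g ε δ * ε ^ 2)) ≤ δ / (2 * g) := by
  have hg0 : (0 : ℝ) < g := by exact_mod_cast hg
  rw [← Real.exp_log (show 0 < δ / (2 * g) by positivity), Real.exp_le_exp,
    ← neg_neg (Real.log (δ / (2 * g))), ← Real.log_inv, inv_div]
  linarith [le_numArms_mul (g := g) (δ := δ) hε]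

/-- Here g/δ ≥ 6 and N ≥ 4, so n/δ ≥ 24 > e³. This supplies the L ≥ 3 of the iterated-logarithm
bound. -/
theorem three_le_log_inv_div {g : ℕ} (hg : 2 ≤ g) (hε : 0 < ε) (hε2 : ε < 1 / 2) (hδ : 0 < δ)
    (hδ3 : δ < 1 / 3) : 3 ≤ Real.log (1 / (δ / (numArms g ε δ * g : ℕ))) := by
  have hg2 : (2 : ℝ) ≤ g := by exact_mod_cast hg
  have h6 : 6 ≤ g / δ := by
    rw [le_div_iff₀ hδ]
    linarith
  have he := Real.exp_one_lt_d9
  have hlog : 2 ≤ Real.log (2 * g / δ) := by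
    rw [Real.le_log_iff_exp_le (by positivity), mul_div_assoc]
    have h3 : Real.exp 1 ^ 2 ≤ 2.72 ^ 2 :=
      pow_le_pow_left₀ (Real.exp_pos 1).le (by linarith) 2
    rw [← Real.exp_nat_mul] at h3
    norm_num at h3 ⊢
    linarith
  have hN : (4 : ℝ) ≤ numArms g ε δ := by
    have h := le_numArms_mul (g := g) (δ := δ) hε
    have hN0 : (0 : ℝ) ≤ numArms g ε δ := Nat.cast_nonneg _
    have h4 : 2 * ε ^ 2 ≤ 1 / 2 := by nlinarith
    nlinarith
  rw [one_div_div, Nat.cast_mul, mul_div_assoc,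
    Real.le_log_iff_exp_le (mul_pos (by linarith) (by linarith))]
  have h3 : Real.exp 1 ^ 3 ≤ 2.72 ^ 3 := pow_le_pow_left₀ (Real.exp_pos 1).le (by linarith) 3
  rw [← Real.exp_nat_mul] at h3
  norm_num at h3
  nlinarith

/-- The deviation 2ε for cells quadruples the Hoeffding exponent, hence the fourth power. Since mδ ≤
mε ≤ 2, one factor pays for the number of cells. -/
theorem numCells_mul_pow_le {g : ℕ} (hg : 1 ≤ g) (hα : α ∈ Set.Ioo (0 : ℝ) 1) (hδ : 0 < δ)
    (hδε : δ < ε) (hε2 : ε < 1 / 2) : numCells α ε * (δ / (2 * g)) ^ 4 ≤ δ / g := by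
  have hε : 0 < ε := hδ.trans hδε
  have hg1 : (1 : ℝ) ≤ g := by exact_mod_cast hg
  have hm : numCells α ε * δ ≤ 2 :=
    (mul_le_mul_of_nonneg_left hδε.le (Nat.cast_nonneg _)).trans
      ((numCells_mul_le hε hα).trans (by linarith))
  have hu : δ / (2 * g) ≤ 1 / 2 := by
    rw [div_le_div_iff₀ (by positivity) (by norm_num)]
    nlinarith
  have hu0 : 0 ≤ δ / (2 * g) := by positivity
  have hmu : numCells α ε * (δ / (2 * g)) ≤ 1 := by
    calc numCells α ε * (δ / (2 * g)) = numCells α ε * δ / (2 * g) := by ring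
      _ ≤ 1 := by
        rw [div_le_one (by positivity)]
        linarith
  have hu2 : (δ / (2 * g)) ^ 2 ≤ 1 := pow_le_one₀ hu0 (by linarith)
  calc numCells α ε * (δ / (2 * g)) ^ 4
      = numCells α ε * (δ / (2 * g)) * ((δ / (2 * g)) ^ 2 * (δ / (2 * g))) := by ring
    _ ≤ 1 * (1 * (δ / (2 * g))) := by gcongr
    _ ≤ δ / g := by
        rw [one_mul, one_mul]
        exact div_le_div_of_nonneg_left hδ.le (by positivity) (by linarith)

open Classical in
/-- All but a `3 δ` fraction of the outcomes are good. -/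
theorem environment_not_goodOutcome_le {s : NNReal} (hs : s ≤ 1)
    (hν : ∀ G, ∀ᵐ m ∂(ν G), m ∈ Set.Icc (0 : ℝ) 1)
    (hsub : ∀ m ∈ Set.Icc (0 : ℝ) 1, HasSubgaussianMGF (fun x => x - m) s (κ m))
    (hα : α ∈ Set.Ioo (0 : ℝ) 1) (hδ : 0 < δ) (hδε : δ < ε) (hεα : ε < min α (1 - α))
    (hcard : 2 ≤ Fintype.card ι) (hδ3 : δ < 1 / 3) :
    environment (numArms (Fintype.card ι) ε δ) ν κ {ω | ¬ GoodOutcome ν α ε δ ω}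
      ≤ ENNReal.ofReal (3 * δ) := by
  have hε : 0 < ε := hδ.trans hδε
  obtain ⟨hεα1, hεα2⟩ := lt_min_iff.mp hεα
  have hε2 : ε < 1 / 2 := by linarith
  set g := Fintype.card ι with hg
  have hg1 : 1 ≤ g := by omega
  have hg0 : (0 : ℝ) < g := by exact_mod_cast hg1
  have hL := three_le_log_inv_div hcard hε hε2 hδ hδ3
  have hN0 := numArms_pos hg1 hε hδ (hδε.trans hε2)
  have hexp := exp_neg_numArms_le hg1 hε hδ
  set N := numArms g ε δ
  set E := environment N ν κ
  have hNg : (0 : ℝ) < (N * g : ℕ) := by exact_mod_cast Nat.mul_pos hN0 hg1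
  set bad0 : Set (Outcome ι N) := {ω | ∃ G k, (ω (G, k)).1 ∉ Set.Ioo (0 : ℝ) 1}
  set badC : Set (Outcome ι N) := {ω | ∃ G k,
    ¬ ConfidenceValid (δ / (N * g : ℕ)) (quantile (ν G) (ω (G, k)).1) (ω (G, k)).2}
  set badI : Set ℝ → ℝ → ℝ → ι → Set (Outcome ι N) := fun A p u G =>
    {ω | (p + u) * N ≤ (Finset.univ.filter fun k => (ω (G, k)).1 ∈ A).card} with hbadI
  have h0 : E bad0 = 0 := environment_index_notMem_Ioo ν κ
  have hC : E badC ≤ ENNReal.ofReal δ := by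
    refine (environment_exists_not_confidenceValid_le ν κ hs hν hsub (by positivity) hL).trans
      (le_of_eq ?_)
    rw [mul_div_cancel₀ _ hNg.ne']
  have hU : ∀ G, E (badI (Set.Ioi (1 - α + ε)) (α - ε) ε G) ≤ ENNReal.ofReal (δ / (2 * g)) := by
    intro G
    refine (environment_le_card_index_mem_le ν κ G measurableSet_Ioi ?_ hε.le).trans
      (ENNReal.ofReal_le_ofReal hexp)
    refine ENNReal.toReal_le_of_le_ofReal (by linarith) ?_
    rw [Measure.restrict_apply measurableSet_Ioi]
    refine (measure_mono (t := Set.Icc (1 - α + ε) 1) fun x hx => ⟨hx.1.le, hx.2.2⟩).trans ?_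
    rw [Real.volume_Icc]
    exact ENNReal.ofReal_le_ofReal (by linarith)
  have hD : ∀ G, E (badI (Set.Iio (1 - α - ε)) (1 - α - ε) ε G)
      ≤ ENNReal.ofReal (δ / (2 * g)) := by
    intro G
    refine (environment_le_card_index_mem_le ν κ G measurableSet_Iio ?_ hε.le).trans
      (ENNReal.ofReal_le_ofReal hexp)
    refine ENNReal.toReal_le_of_le_ofReal (by linarith) ?_
    rw [Measure.restrict_apply measurableSet_Iio]
    refine (measure_mono (t := Set.Icc 0 (1 - α - ε)) fun x hx => ⟨hx.2.1, hx.1.le⟩).trans ?_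
    rw [Real.volume_Icc]
    exact ENNReal.ofReal_le_ofReal (by linarith)
  have hK : ∀ G i, E (badI (cell α ε i) (2 * ε) (2 * ε) G)
      ≤ ENNReal.ofReal ((δ / (2 * g)) ^ 4) := by
    intro G i
    refine (environment_le_card_index_mem_le ν κ G measurableSet_Icc (measureReal_cell_le hε i)
      (by positivity)).trans (ENNReal.ofReal_le_ofReal ?_)
    refine le_trans (le_of_eq ?_) (pow_le_pow_left₀ (Real.exp_pos _).le hexp 4)
    rw [← Real.exp_nat_mul]
    congr 1
    push_cast
    ring
  -- Per group the budget is δ/(2g) for each of the two tails and δ/g for all cells; over all groups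
  -- this is 2δ, and the confidence intervals take the third δ.
  have hG : ∀ G, E (badI (Set.Ioi (1 - α + ε)) (α - ε) ε G ∪
      (badI (Set.Iio (1 - α - ε)) (1 - α - ε) ε G ∪
        ⋃ i ∈ Finset.Icc 1 (numCells α ε), badI (cell α ε i) (2 * ε) (2 * ε) G))
      ≤ ENNReal.ofReal (2 * (δ / g)) := by
    intro G
    have hcells : E (⋃ i ∈ Finset.Icc 1 (numCells α ε), badI (cell α ε i) (2 * ε) (2 * ε) G)
        ≤ ENNReal.ofReal (δ / g) := by
      refine (measure_biUnion_finset_le _ _).trans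
        ((Finset.sum_le_sum fun i _ => hK G i).trans ?_)
      rw [Finset.sum_const, Nat.card_Icc, Nat.add_sub_cancel, nsmul_eq_mul,
        ← ENNReal.ofReal_natCast, ← ENNReal.ofReal_mul (Nat.cast_nonneg _)]
      exact ENNReal.ofReal_le_ofReal (numCells_mul_pow_le hg1 hα hδ hδε hε2)
    refine (measure_union_le _ _).trans ((add_le_add (hU G)
      ((measure_union_le _ _).trans (add_le_add (hD G) hcells))).trans (le_of_eq ?_))
    rw [← ENNReal.ofReal_add (by positivity) (by positivity),
      ← ENNReal.ofReal_add (by positivity) (by positivity)]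
    congr 1
    field_simp
    ring
  calc E {ω | ¬ GoodOutcome ν α ε δ ω}
      ≤ E (bad0 ∪ (badC ∪ ⋃ G ∈ (Finset.univ : Finset ι),
        (badI (Set.Ioi (1 - α + ε)) (α - ε) ε G ∪ (badI (Set.Iio (1 - α - ε)) (1 - α - ε) ε G ∪
          ⋃ i ∈ Finset.Icc 1 (numCells α ε), badI (cell α ε i) (2 * ε) (2 * ε) G)))) := by
        refine measure_mono fun ω hω => ?_
        by_contra hcon
        simp only [Set.mem_union, Set.mem_iUnion, not_or, not_exists] at hcon
        obtain ⟨c0, c1, c2⟩ := hcon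
        refine hω ⟨fun G k => ?_, fun G k => ?_, fun G => ?_, fun G => ?_, fun G i hi => ?_⟩
        · by_contra h
          exact c0 ⟨G, k, h⟩
        · by_contra h
          exact c1 ⟨G, k, h⟩
        · exact not_le.mp (c2 G (Finset.mem_univ G)).1
        · exact not_le.mp (c2 G (Finset.mem_univ G)).2.1
        · exact not_le.mp ((c2 G (Finset.mem_univ G)).2.2 i hi)
    _ ≤ 0 + (ENNReal.ofReal δ + ∑ _G : ι, ENNReal.ofReal (2 * (δ / g))) := by
        refine (measure_union_le _ _).trans (add_le_add h0.le ?_)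
        refine (measure_union_le _ _).trans (add_le_add hC ?_)
        exact (measure_biUnion_finset_le _ _).trans (Finset.sum_le_sum fun G _ => hG G)
    _ = ENNReal.ofReal (3 * δ) := by
        rw [Finset.sum_const, Finset.card_univ, ← hg, nsmul_eq_mul, zero_add,
          ← ENNReal.ofReal_natCast, ← ENNReal.ofReal_mul (Nat.cast_nonneg _),
          ← ENNReal.ofReal_add hδ.le (by positivity)]
        congr 1
        field_simp
        norm_num

end Probability

theorem instanceBound_nonneg {ι : Type*} [Fintype ι] [Nonempty ι] {ν : ι → Measure ℝ}
    {α ε Δ δ c : ℝ} {Gs : ι} (hc : 0 ≤ c) (hδ : 0 < δ) (hδε : δ < ε) (hε2 : ε < 1 / 2) :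
    0 ≤ instanceBound c ν α ε Δ δ Gs := by
  have hε : 0 < ε := hδ.trans hδε
  have hg1 : 1 ≤ Fintype.card ι := Fintype.card_pos
  have h2 := two_lt_natCast_div hg1 hδ (hδε.trans hε2)
  have hN1 : (1 : ℝ) ≤ numArms (Fintype.card ι) ε δ := by
    exact_mod_cast numArms_pos hg1 hε hδ (hδε.trans hε2)
  refine Finset.sum_nonneg fun G _ => Finset.sum_nonneg fun i _ => ?_
  refine mul_nonneg (mul_nonneg (by positivity) (Real.log_nonneg ?_)) (by positivity)
  refine one_le_mul_of_one_le_of_one_le ?_ (le_max_left _ _)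
  rw [mul_div_right_comm]
  nlinarith

end QuantileBandit

/-! ### The main theorem -/

open MeasureTheory ProbabilityTheory QuantileBandit in
theorem mainTheorem3 :
    ∃ c d : ℝ, 0 < c ∧ 0 < d ∧
      ∀ (ι : Type u) [Fintype ι] [Nonempty ι]
        (ν : ι → Measure ℝ) [∀ G, IsProbabilityMeasure (ν G)]
        (κ : Kernel ℝ ℝ) [IsMarkovKernel κ] (σsq : NNReal)
        (α ε Δ δ : ℝ) (Gs : ι),
        (∀ G, ∀ᵐ m ∂(ν G), m ∈ Set.Icc (0 : ℝ) 1) →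
        σsq ≤ 1 →
        (∀ m ∈ Set.Icc (0 : ℝ) 1,
          ∫ x, x ∂(κ m) = m ∧ HasSubgaussianMGF (fun x => x - m) σsq (κ m)) →
        α ∈ Set.Ioo (0 : ℝ) 1 → 0 < δ → δ < ε → ε < min α (1 - α) → Δ ∈ Set.Ioo (0 : ℝ) 1 →
        (∀ G, quantile (ν G) (1 - α + ε) ≤ quantile (ν Gs) (1 - α + ε)) →
        environment (numArms (Fintype.card ι) ε δ) ν κ
            {ω | ¬ Succeeds ν α ε Δ δ (instanceBound c ν α ε Δ δ Gs) ω}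
          ≤ ENNReal.ofReal (3 * δ) ∧
        instanceBound c ν α ε Δ δ Gs ≤ worstCaseBound d (Fintype.card ι) ε Δ δ := by
  refine ⟨556, 72 * 556, by norm_num, by norm_num, ?_⟩
  intro ι _ _ ν _ κ _ σsq α ε Δ δ Gs hν hσ hκ hα hδ hδε hεα hΔ _
  refine ⟨?_, instanceBound_le_worstCaseBound (by norm_num) hα hδ hδε hεα hΔ⟩
  have hε : 0 < ε := hδ.trans hδε
  have hε2 : ε < 1 / 2 := by
    have := lt_min_iff.mp hεα
    linarith [this.1, this.2]
  -- For δ ≥ 1/3 the allowed failure probability is at least 1.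
  rcases le_or_gt (1 / 3) δ with hδ3 | hδ3
  · refine prob_le_one.trans ?_
    rw [← ENNReal.ofReal_one]
    exact ENNReal.ofReal_le_ofReal (by linarith)
  rcases Nat.lt_or_ge (Fintype.card ι) 2 with hcard | hcard
  · have hempty : {ω | ¬ Succeeds ν α ε Δ δ (instanceBound 556 ν α ε Δ δ Gs) ω}
        = (∅ : Set (Outcome ι (numArms (Fintype.card ι) ε δ))) :=
      Set.eq_empty_of_forall_notMem fun ω hω => hω (succeeds_of_card_le_one hε hεα hΔ.1.le
        (by omega) (instanceBound_nonneg (by norm_num) hδ hδε hε2) ω)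
    rw [hempty, measure_empty]
    exact zero_le
  · have hsub : {ω | ¬ Succeeds ν α ε Δ δ (instanceBound 556 ν α ε Δ δ Gs) ω}
        ⊆ {ω : Outcome ι (numArms (Fintype.card ι) ε δ) | ¬ GoodOutcome ν α ε δ ω} :=
      fun ω hω hgood => hω (succeeds_of_goodOutcome hν
        (numArms_pos (by omega) hε hδ (hδε.trans hε2)) hδ (three_le_log_inv_div hcard hε hε2 hδ hδ3)
        hε hεα hα hΔ hcard hgood)
    exact (measure_mono hsub).trans
      (environment_not_goodOutcome_le ν κ hσ hν (fun m hm => (hκ m hm).2) hα hδ hδε hεα hcard hδ3)
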